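/- Let $I=(-1,1)$, $1<q<\infty$, $\theta_0\in[0,1]$, and let $L^q(I)$ be the complex Lebesgue space. For $u\in H^{2,q}(I)$ (that is, $u\in L^q(I)$ with weak derivatives $\partial_x u,\partial_x^2u\in L^q(I)$) consider the FK (Furukawa–Kitahata) boundary conditions $$B_1(\theta_0;u)=(1-\theta_0)\,u(1)-u(-1)=0,\qquad B_2(\theta_0;u)=\partial_xu(1)-(1-\theta_0)\,\partial_xu(-1)=0,$$ where boundary values are those of the representatives continuous on $[-1,1]$. Let $A_q u=\partial_x^2u$ with domain $D(A_q)=\{u\in H^{2,q}(I): B_1(\theta_0;u)=B_2(\theta_0;u)=0\}$, and for $\phi\in(0,\pi)$ let $\Sigma_\phi=\{\lambda\in\mathbb C\setminus\{0\}: |\arg\lambda|<\phi\}$. Then: 1. For every $\phi\in(\pi/2,\pi)$ there is a constant $C$ (depending only on $q,\theta_0,\phi$) such that for every $\lambda\in\Sigma_\phi$ and every $f\in L^q(I)$ the equation $\lambda u-A_qu=f$ has a unique solution $u\in D(A_q)$, and $$|\lambda|\,\|u\|_{L^q(I)}+\|A_qu\|_{L^q(I)}\le C\|f\|_{L^q(I)}.$$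 2. If $\theta_0\in(0,1]$, then $0$ belongs to the resolvent set of $A_q$. 3. The spectrum of $A_q$ is contained in the real half-line $(-\infty,0]$, and in $(-\infty,0)$ if $\theta_0\in(0,1]$. 4. $A_q$ generates an analytic semigroup on $L^q(I)$: there are $\delta\in(0,\pi/2]$ and bounded operators $T(z)$, $z\in\Sigma_\delta\cup\{0\}$, on $L^q(I)$ with $T(0)=\mathrm{Id}$, $T(z+w)=T(z)T(w)$ for $z,w\in\Sigma_\delta$, $z\mapsto T(z)$ holomorphic on $\Sigma_\delta$ in operator norm, $T(z)f\to f$ as $z\to0$ in $\Sigma_{\delta'}$ for all $f\in L^q(I)$ and $0<\delta'<\delta$, and $A_q$ (with domain exactly $D(A_q)$) is the infinitesimal generator of $(T(t))_{t\ge0}$. -/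

import Mathlib

open MeasureTheory Filter Topology Set
open scoped ENNReal ContDiff

noncomputable section

namespace FK

/-- The open interval `I = (-1, 1)`. -/
abbrev I : Set ℝ := Ioo (-1 : ℝ) 1

/-- The complex Lebesgue space `L^q(I)`. -/
abbrev LqI (q : ℝ≥0∞) : Type := Lp ℂ q (volume.restrict I)

/-- `g` is the weak derivative of `f` on `I`:
`∫_I φ' f = - ∫_I φ g` for all test functions `φ ∈ C_c^∞(I)`. -/
def IsWeakDeriv {q : ℝ≥0∞} (f g : LqI q) : Prop :=
  ∀ φ : ℝ → ℝ, ContDiff ℝ ∞ φ → HasCompactSupport φ → tsupport φ ⊆ I →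
    ∫ x in I, deriv φ x • f x = - ∫ x in I, φ x • g x

/-- `F` is a representative of `f` that is continuous up to the boundary of `I`; its values at
`±1` are the boundary traces `γ_± f`. (The values of such an `F` on `[-1, 1]` are unique.) -/
def IsContRep {q : ℝ≥0∞} (f : LqI q) (F : ℝ → ℂ) : Prop :=
  ContinuousOn F (Icc (-1 : ℝ) 1) ∧ ∀ᵐ x ∂(volume.restrict I), F x = f x

/-- `B₁(θ; φ) = (1 - θ) φ(1) - φ(-1)`, where `F` is the continuous representative of `φ`. -/
def B₁ (θ : ℝ) (F : ℝ → ℂ) : ℂ := (1 - (θ : ℂ)) * F 1 - F (-1)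

/-- `B₂(θ; φ) = φ'(1) - (1 - θ) φ'(-1)`, where `G` is the continuous representative of the
derivative `φ'`. -/
def B₂ (θ : ℝ) (G : ℝ → ℂ) : ℂ := G 1 - (1 - (θ : ℂ)) * G (-1)

/-- `u` belongs to `H^{2,q}(I)` with first and second weak derivatives `v`, `w` in `L^q(I)`, and
satisfies `B₁(θ; u) = 0`, `B₂(θ; u) = 0`. -/
def IsFK {q : ℝ≥0∞} (θ : ℝ) (u v w : LqI q) : Prop :=
  IsWeakDeriv u v ∧ IsWeakDeriv v w ∧
    ∃ F G : ℝ → ℂ, IsContRep u F ∧ IsContRep v G ∧ B₁ θ F = 0 ∧ B₂ θ G = 0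

section Helpers

variable {q : ℝ≥0∞} [hq : Fact (1 ≤ q)]

theorem LqI.integrable (f : LqI q) : Integrable f (volume.restrict I) :=
  (Lp.memLp f).integrable hq.out

theorem integrable_smul_of_test {ψ : ℝ → ℝ} (hψ : Continuous ψ) (hc : HasCompactSupport ψ)
    (f : LqI q) : Integrable (fun x => ψ x • f x) (volume.restrict I) :=
  (LqI.integrable f).locallyIntegrable.integrable_smul_left_of_hasCompactSupport hψ hc

theorem IsWeakDeriv.add {f g f' g' : LqI q} (h : IsWeakDeriv f g) (h' : IsWeakDeriv f' g') :
    IsWeakDeriv (f + f') (g + g') := by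
  intro φ hφ hc hs
  have hd : Continuous (deriv φ) := hφ.continuous_deriv (by simp)
  have e1 : ∫ x in I, deriv φ x • (f + f' : LqI q) x
      = ∫ x in I, (deriv φ x • f x + deriv φ x • f' x) := by
    refine integral_congr_ae ?_
    filter_upwards [Lp.coeFn_add f f'] with x hx
    rw [hx, Pi.add_apply, smul_add]
  have e2 : ∫ x in I, φ x • (g + g' : LqI q) x = ∫ x in I, (φ x • g x + φ x • g' x) := by
    refine integral_congr_ae ?_
    filter_upwards [Lp.coeFn_add g g'] with x hx
    rw [hx, Pi.add_apply, smul_add]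
  rw [e1, e2, integral_add (integrable_smul_of_test hd hc.deriv f)
    (integrable_smul_of_test hd hc.deriv f'), integral_add
    (integrable_smul_of_test hφ.continuous hc g) (integrable_smul_of_test hφ.continuous hc g'),
    h φ hφ hc hs, h' φ hφ hc hs, neg_add]

theorem IsWeakDeriv.smul (c : ℂ) {f g : LqI q} (h : IsWeakDeriv f g) :
    IsWeakDeriv (c • f) (c • g) := by
  intro φ hφ hc hs
  have e1 : ∫ x in I, deriv φ x • (c • f : LqI q) x = ∫ x in I, c • (deriv φ x • f x) := by
    refine integral_congr_ae ?_
    filter_upwards [Lp.coeFn_smul c f] with x hx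
    rw [hx, Pi.smul_apply, smul_comm]
  have e2 : ∫ x in I, φ x • (c • g : LqI q) x = ∫ x in I, c • (φ x • g x) := by
    refine integral_congr_ae ?_
    filter_upwards [Lp.coeFn_smul c g] with x hx
    rw [hx, Pi.smul_apply, smul_comm]
  rw [e1, e2, integral_smul, integral_smul, h φ hφ hc hs, smul_neg]

theorem IsWeakDeriv.zero : IsWeakDeriv (0 : LqI q) 0 := by
  simpa using (IsWeakDeriv.smul (0 : ℂ) (f := (0 : LqI q)) (g := 0) (by
    intro φ hφ hc hs
    have e : ∀ ψ : ℝ → ℝ, ∫ x in I, ψ x • (0 : LqI q) x = 0 := fun ψ => by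
      rw [integral_congr_ae (g := fun _ => (0 : ℂ)), integral_zero]
      filter_upwards [Lp.coeFn_zero ℂ q (volume.restrict I)] with x hx
      rw [hx]
      simp
    rw [e, e, neg_zero]))

theorem IsWeakDeriv.unique {f g g' : LqI q} (h : IsWeakDeriv f g) (h' : IsWeakDeriv f g') :
    g = g' := by
  have hint : Integrable (fun x => g x - g' x) (volume.restrict I) :=
    (LqI.integrable g).sub (LqI.integrable g')
  have key := isOpen_Ioo.ae_eq_zero_of_integral_contDiff_smul_eq_zero (U := I)
    (f := fun x => g x - g' x) (μ := volume.restrict I)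
    (hint.locallyIntegrable.locallyIntegrableOn I)
    (fun φ hφ hc hs => by
      have e := (h φ hφ hc hs).symm.trans (h' φ hφ hc hs)
      have e' := neg_injective e
      simp only [smul_sub]
      rw [integral_sub (integrable_smul_of_test hφ.continuous hc g)
        (integrable_smul_of_test hφ.continuous hc g'), e', sub_self])
  refine Lp.ext ?_
  filter_upwards [key, ae_restrict_mem (μ := volume) (measurableSet_Ioo : MeasurableSet I)]
    with x hx hxI
  exact sub_eq_zero.1 (hx hxI)

theorem IsContRep.add {f f' : LqI q} {F F' : ℝ → ℂ} (h : IsContRep f F) (h' : IsContRep f' F') :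
    IsContRep (f + f') (F + F') := by
  refine ⟨h.1.add h'.1, ?_⟩
  filter_upwards [h.2, h'.2, Lp.coeFn_add f f'] with x h1 h2 h3
  rw [h3, Pi.add_apply, Pi.add_apply, h1, h2]

theorem IsContRep.smul (c : ℂ) {f : LqI q} {F : ℝ → ℂ} (h : IsContRep f F) :
    IsContRep (c • f) (c • F) := by
  refine ⟨h.1.const_smul c, ?_⟩
  filter_upwards [h.2, Lp.coeFn_smul c f] with x h1 h3
  rw [h3, Pi.smul_apply, Pi.smul_apply, h1]

theorem IsFK.add {θ : ℝ} {u v w u' v' w' : LqI q} (h : IsFK θ u v w) (h' : IsFK θ u' v' w') :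
    IsFK θ (u + u') (v + v') (w + w') := by
  obtain ⟨h1, h2, F, G, hF, hG, b1, b2⟩ := h
  obtain ⟨h1', h2', F', G', hF', hG', b1', b2'⟩ := h'
  refine ⟨h1.add h1', h2.add h2', F + F', G + G', hF.add hF', hG.add hG', ?_, ?_⟩
  · simp only [B₁, Pi.add_apply] at *
    linear_combination b1 + b1'
  · simp only [B₂, Pi.add_apply] at *
    linear_combination b2 + b2'

theorem IsFK.smul {θ : ℝ} (c : ℂ) {u v w : LqI q} (h : IsFK θ u v w) :
    IsFK θ (c • u) (c • v) (c • w) := by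
  obtain ⟨h1, h2, F, G, hF, hG, b1, b2⟩ := h
  refine ⟨h1.smul c, h2.smul c, c • F, c • G, hF.smul c, hG.smul c, ?_, ?_⟩
  · simp only [B₁, Pi.smul_apply, smul_eq_mul] at *
    linear_combination c * b1
  · simp only [B₂, Pi.smul_apply, smul_eq_mul] at *
    linear_combination c * b2

theorem IsFK.zero (θ : ℝ) : IsFK θ (0 : LqI q) 0 0 := by
  have h0 : IsContRep (0 : LqI q) (fun _ => 0) := by
    refine ⟨continuousOn_const, ?_⟩
    filter_upwards [Lp.coeFn_zero ℂ q (volume.restrict I)] with x hx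
    rw [hx, Pi.zero_apply]
  exact ⟨IsWeakDeriv.zero, IsWeakDeriv.zero, _, _, h0, h0, by simp [B₁], by simp [B₂]⟩

theorem IsFK.unique {θ : ℝ} {u v w v' w' : LqI q} (h : IsFK θ u v w) (h' : IsFK θ u v' w') :
    w = w' := by
  have hv : v = v' := h.1.unique h'.1
  subst hv
  exact h.2.1.unique h'.2.1

end Helpers

/-- The domain `D(A_q(θ)) = {u ∈ H^{2,q}(I) : B₁(θ; u) = B₂(θ; u) = 0}`. -/
def domA (q : ℝ≥0∞) [Fact (1 ≤ q)] (θ : ℝ) : Submodule ℂ (LqI q) where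
  carrier := {u | ∃ v w : LqI q, IsFK θ u v w}
  zero_mem' := ⟨0, 0, IsFK.zero θ⟩
  add_mem' := by
    rintro a b ⟨v, w, h⟩ ⟨v', w', h'⟩
    exact ⟨_, _, h.add h'⟩
  smul_mem' := by
    rintro c a ⟨v, w, h⟩
    exact ⟨_, _, h.smul c⟩

/-- The operator `A_q(θ) = ∂_x²` (second weak derivative) in `L^q(I)` with domain
`D(A_q(θ))`. -/
def opA (q : ℝ≥0∞) [Fact (1 ≤ q)] (θ : ℝ) : LqI q →ₗ.[ℂ] LqI q where
  domain := domA q θ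
  toFun :=
    { toFun := fun u => u.2.choose_spec.choose
      map_add' := fun a b =>
        (a + b).2.choose_spec.choose_spec.unique
          (a.2.choose_spec.choose_spec.add b.2.choose_spec.choose_spec)
      map_smul' := fun c a =>
        (c • a).2.choose_spec.choose_spec.unique (a.2.choose_spec.choose_spec.smul c) }

/-- `A_q(θ) u = w` exactly when `w` is the second weak derivative of `u` (and `u` is in the
domain). -/
theorem mem_graph_opA {q : ℝ≥0∞} [Fact (1 ≤ q)] {θ : ℝ} {u w : LqI q} :
    (u, w) ∈ (opA q θ).graph ↔ ∃ v, IsFK θ u v w := by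
  rw [LinearPMap.mem_graph_iff]
  constructor
  · rintro ⟨y, rfl, hy⟩
    refine ⟨y.2.choose, ?_⟩
    have h := y.2.choose_spec.choose_spec
    have e : (opA q θ) y = y.2.choose_spec.choose := rfl
    rw [← e, hy] at h
    exact h
  · rintro ⟨v, h⟩
    have hu : u ∈ domA q θ := ⟨v, w, h⟩
    exact ⟨⟨u, hu⟩, rfl, hu.choose_spec.choose_spec.unique h⟩

/-- The open sector `Σ_φ = {λ ≠ 0 : |arg λ| < φ}`. -/
def sector (φ : ℝ) : Set ℂ := {z | z ≠ 0 ∧ |z.arg| < φ}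

section Abstract

variable {X : Type*} [NormedAddCommGroup X] [NormedSpace ℂ X]

/-- The resolvent set of an unbounded operator `A : D(A) ⊆ X → X`: all `z` for which
`z - A : D(A) → X` has a bounded two-sided inverse `R : X → D(A)`. -/
def resolventSet (A : X →ₗ.[ℂ] X) : Set ℂ :=
  {z | ∃ R : X →L[ℂ] X, (∀ f : X, ∃ u : A.domain, (u : X) = R f ∧ z • (u : X) - A u = f) ∧
    ∀ u : A.domain, R (z • (u : X) - A u) = u}

/-- The spectrum of an unbounded operator. -/
def spectrum (A : X →ₗ.[ℂ] X) : Set ℂ := (resolventSet A)ᶜ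

/-- `T` (restricted to `sector δ ∪ {0}`) is an analytic semigroup of angle `δ`. -/
structure IsAnalyticSemigroup (δ : ℝ) (T : ℂ → X →L[ℂ] X) : Prop where
  map_zero : T 0 = ContinuousLinearMap.id ℂ X
  map_add : ∀ z ∈ sector δ, ∀ w ∈ sector δ, T (z + w) = (T z).comp (T w)
  holomorphic : DifferentiableOn ℂ T (sector δ)
  continuous_zero : ∀ δ' : ℝ, 0 < δ' → δ' < δ → ∀ x : X,
    Tendsto (fun z => T z x) (𝓝[sector δ'] 0) (𝓝 x)

/-- `A` is the infinitesimal generator of `(T t)_{t ≥ 0}`: `x ∈ D(A)` with `A x = y` if and only if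
`(T t x - x) / t → y` as `t → 0+`. -/
def IsGenerator (A : X →ₗ.[ℂ] X) (T : ℂ → X →L[ℂ] X) : Prop :=
  ∀ x y : X, (x, y) ∈ A.graph ↔
    Tendsto (fun t : ℝ => (t : ℂ)⁻¹ • (T (t : ℂ) x - x)) (𝓝[>] 0) (𝓝 y)

/-- `A` generates an analytic semigroup (of some angle `δ ∈ (0, π/2]`) on `X`. -/
def GeneratesAnalyticSemigroup (A : X →ₗ.[ℂ] X) : Prop :=
  ∃ δ : ℝ, 0 < δ ∧ δ ≤ Real.pi / 2 ∧
    ∃ T : ℂ → X →L[ℂ] X, IsAnalyticSemigroup δ T ∧ IsGenerator A T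

end Abstract

end FK

end

/-! Write a = 1 - θ₀ and (Rf)(x) = f(-x). If u satisfies the FK conditions, then U = u + iRu
satisfies U(-1) = ηU(1) and U'(-1) = ηU'(1) with η = (a + i)/(1 + ia), a number of modulus 1. The
map 1 + iR has inverse (1 - iR)/2 and commutes with the second derivative, so A_q is similar to ∂ₓ²
under quasi-periodic conditions. That operator is the square of the generator of a group of
isometries of L^q: translation, with a phase picked up at each crossing of the endpoint. Hence A_q =
D², where D generates a group G bounded by 2.

The rest is abstract. With μ = √z and Re μ > 0 one has z - D² = (μ - D)(μ + D), and each factor is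
inverted by a Laplace transform of G (`exists_resolvent`). If η ≠ 1, then D is inverted by a
multiple of the integral of G over one period (`exists_inverse`). The semigroup exp(zD²) is a
Gaussian average of G (`heat`).

The generator D itself never appears. Identities are tested against the functionals ℓ n given by the
adjoint eigenfunctions e^{-iκx} + ie^{iκx}; these turn each operator into a scalar symbol, and they
separate points because the Fourier exponentials are complete. The link with A_q is
`mem_graph_opA_iff_pairing`: the graph consists of the pairs with ℓ n w = -κ²ℓ n u for all n. One
direction is integration by parts; the other compares u with a solution of u' - ∂ₓ²u' = u - w from
`exists_isFK_sub_eq`. -/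

noncomputable section

namespace FK

/-! ### Bounded diagonal groups: averages, resolvents, inverse of the squared generator. -/

section DiagonalGroup

variable {X : Type*} [NormedAddCommGroup X] [NormedSpace ℂ X] {ι : Type*}

/-- `G` is a bounded, strongly continuous family of operators on `X` that is diagonalised by a
separating family of functionals `ℓ n` with eigenvalues `exp (i κ n s)`. -/
structure IsDiagonalGroup (M : ℝ) (G : ℝ → X →L[ℂ] X) (κ : ι → ℝ) (ℓ : ι → X →L[ℂ] ℂ) : Prop where
  norm_le : ∀ s, ‖G s‖ ≤ M
  continuous : ∀ x, Continuous fun s => G s x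
  eigen : ∀ n s x, ℓ n (G s x) = Complex.exp (Complex.I * κ n * s) * ℓ n x
  separates : ∀ x, (∀ n, ℓ n x = 0) → x = 0

namespace IsDiagonalGroup

variable {M : ℝ} {G : ℝ → X →L[ℂ] X} {κ : ι → ℝ} {ℓ : ι → X →L[ℂ] ℂ}

theorem ext (hG : IsDiagonalGroup M G κ ℓ) {x y : X} (h : ∀ n, ℓ n x = ℓ n y) : x = y :=
  sub_eq_zero.1 (hG.separates _ fun n => by rw [map_sub, h n, sub_self])

theorem bound_nonneg (hG : IsDiagonalGroup M G κ ℓ) : 0 ≤ M := (norm_nonneg _).trans (hG.norm_le 0)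

theorem norm_apply_le (hG : IsDiagonalGroup M G κ ℓ) (s : ℝ) (x : X) : ‖G s x‖ ≤ M * ‖x‖ :=
  (G s).le_of_opNorm_le (hG.norm_le s) x

/-- The group axioms are not assumed: they are consequences of the eigenvalue relation and
separation. -/
theorem map_zero (hG : IsDiagonalGroup M G κ ℓ) (x : X) : G 0 x = x :=
  hG.ext fun n => by simp [hG.eigen]

/-- Time reversal replaces D by -D, so a statement about μ - D also gives one about μ + D. -/
theorem reverse (hG : IsDiagonalGroup M G κ ℓ) :
    IsDiagonalGroup M (fun s => G (-s)) (fun n => -κ n) ℓ where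
  norm_le s := hG.norm_le _
  continuous x := (hG.continuous x).comp continuous_neg
  eigen n s x := by
    rw [hG.eigen]
    congr 2
    push_cast
    ring
  separates := hG.separates

theorem integrable_smul (hG : IsDiagonalGroup M G κ ℓ) {k : ℝ → ℂ} (hk : Integrable k) (x : X) :
    Integrable fun s => k s • G s x := by
  refine (hk.norm.mul_const (M * ‖x‖)).mono'
    (hk.1.smul (hG.continuous x).aestronglyMeasurable) (Eventually.of_forall fun s => ?_)
  rw [norm_smul]
  exact mul_le_mul_of_nonneg_left (hG.norm_apply_le s x) (norm_nonneg _)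

theorem norm_integral_smul_le (hG : IsDiagonalGroup M G κ ℓ) {k : ℝ → ℂ} (hk : Integrable k)
    (x : X) : ‖∫ s, k s • G s x‖ ≤ (M * ∫ s, ‖k s‖) * ‖x‖ := by
  calc ‖∫ s, k s • G s x‖ ≤ ∫ s, ‖k s‖ * (M * ‖x‖) := by
        refine norm_integral_le_of_norm_le (hk.norm.mul_const _) (Eventually.of_forall fun s => ?_)
        rw [norm_smul]
        exact mul_le_mul_of_nonneg_left (hG.norm_apply_le s x) (norm_nonneg _)
    _ = _ := by rw [integral_mul_const]; ring

open Classical in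
/-- The operator `x ↦ ∫ k(s) G(s) x ds` for integrable `k` (and `0` otherwise). -/
def average (hG : IsDiagonalGroup M G κ ℓ) (k : ℝ → ℂ) : X →L[ℂ] X :=
  if hk : Integrable k then
    LinearMap.mkContinuous
      { toFun := fun x => ∫ s, k s • G s x
        map_add' := fun x y => by
          simp only [map_add, smul_add]
          exact integral_add (hG.integrable_smul hk x) (hG.integrable_smul hk y)
        map_smul' := fun c x => by
          simp only [map_smul, smul_comm _ c, RingHom.id_apply]
          exact integral_smul c _ }
      (M * ∫ s, ‖k s‖) (hG.norm_integral_smul_le hk)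
  else 0

theorem average_apply (hG : IsDiagonalGroup M G κ ℓ) {k : ℝ → ℂ} (hk : Integrable k) (x : X) :
    hG.average k x = ∫ s, k s • G s x := by
  rw [average, dif_pos hk]
  rfl

theorem norm_average_le (hG : IsDiagonalGroup M G κ ℓ) {k : ℝ → ℂ} (hk : Integrable k) :
    ‖hG.average k‖ ≤ M * ∫ s, ‖k s‖ :=
  ContinuousLinearMap.opNorm_le_bound _
    (mul_nonneg hG.bound_nonneg (integral_nonneg fun _ => norm_nonneg _)) fun x => by
      rw [hG.average_apply hk]
      exact hG.norm_integral_smul_le hk x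

theorem average_sub (hG : IsDiagonalGroup M G κ ℓ) {k l : ℝ → ℂ} (hk : Integrable k)
    (hl : Integrable l) : hG.average (fun s => k s - l s) = hG.average k - hG.average l := by
  ext x
  have hkl : Integrable fun s => k s - l s := hk.sub hl
  rw [sub_apply, hG.average_apply hk, hG.average_apply hl, hG.average_apply hkl, ← integral_sub (hG.integrable_smul hk x) (hG.integrable_smul hl x)]
  simp only [sub_smul]

theorem average_const_mul (hG : IsDiagonalGroup M G κ ℓ) (c : ℂ) {k : ℝ → ℂ}
    (hk : Integrable k) : hG.average (fun s => c * k s) = c • hG.average k := by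
  ext x
  rw [smul_apply, hG.average_apply hk, hG.average_apply (hk.const_mul c),
    ← integral_smul]
  simp only [mul_smul]

/-- The symbol of an average is the Fourier transform of its kernel, because ℓ n passes under the
Bochner integral. -/
theorem eigen_average [CompleteSpace X] (hG : IsDiagonalGroup M G κ ℓ) {k : ℝ → ℂ}
    (hk : Integrable k) (n : ι) (x : X) :
    ℓ n (hG.average k x) = (∫ s : ℝ, Complex.exp (Complex.I * κ n * s) * k s) * ℓ n x := by
  rw [hG.average_apply hk, ← ContinuousLinearMap.integral_comp_comm _ (hG.integrable_smul hk x),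
    ← integral_mul_const]
  congr 1 with s
  rw [map_smul, hG.eigen, smul_eq_mul]
  ring

/-- The Laplace transform of the group: a bounded inverse of `μ - D`, with `D` the generator. -/
theorem exists_laplace [CompleteSpace X] (hG : IsDiagonalGroup M G κ ℓ) {μ : ℂ} (hμ : 0 < μ.re) :
    ∃ J : X →L[ℂ] X, ‖J‖ ≤ M * μ.re⁻¹ ∧
      ∀ n x, ℓ n (J x) = (μ - Complex.I * κ n)⁻¹ * ℓ n x := by
  set k : ℝ → ℂ := (Ioi (0 : ℝ)).indicator fun s : ℝ => Complex.exp (-μ * s) with hk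
  have hki : Integrable k := by
    rw [hk, integrable_indicator_iff measurableSet_Ioi]
    exact integrableOn_exp_mul_complex_Ioi (a := -μ) (by simpa using hμ) 0
  have hne : ∀ n, μ - Complex.I * κ n ≠ 0 := fun n h => by
    have := congrArg Complex.re h
    simp at this
    exact hμ.ne' this
  refine ⟨hG.average k, (hG.norm_average_le hki).trans_eq ?_, fun n x => ?_⟩
  · congr 1
    have : ∀ s, ‖k s‖ = (Ioi (0 : ℝ)).indicator (fun s : ℝ => Real.exp (-μ.re * s)) s := fun s => by
      rw [hk, norm_indicator_eq_indicator_norm]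
      congr 1
      ext s
      simp [Complex.norm_exp]
    simp only [this]
    rw [integral_indicator measurableSet_Ioi, integral_exp_mul_Ioi (by linarith)]
    simp
  · rw [hG.eigen_average hki]
    congr 1
    have : ∀ s : ℝ, Complex.exp (Complex.I * κ n * s) * k s
        = (Ioi (0 : ℝ)).indicator
          (fun s : ℝ => Complex.exp (-(μ - Complex.I * κ n) * s)) s := fun s => by
      rw [hk]
      by_cases hs : s ∈ Ioi (0 : ℝ)
      · rw [indicator_of_mem hs, indicator_of_mem hs, ← Complex.exp_add]
        congr 1
        ring
      · rw [indicator_of_notMem hs, indicator_of_notMem hs, mul_zero]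
    simp only [this]
    rw [integral_indicator measurableSet_Ioi, integral_exp_mul_complex_Ioi (by simpa using hμ)]
    have := hne n
    simp only [Complex.ofReal_zero, mul_zero, Complex.exp_zero]
    rw [neg_div_neg_eq, one_div]

/-- A bounded operator with symbol `1 / (z + κ²)`, with the sectorial norm bound. -/
theorem exists_resolvent [CompleteSpace X] (hG : IsDiagonalGroup M G κ ℓ) {φ : ℝ}
    (hφ : φ < Real.pi) {z : ℂ} (hz : z ∈ sector φ) :
    (∀ n, z + (κ n : ℂ) ^ 2 ≠ 0) ∧ ∃ R : X →L[ℂ] X, ‖z‖ * ‖R‖ ≤ M ^ 2 / Real.cos (φ / 2) ^ 2 ∧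
      ∀ n x, ℓ n (R x) = (z + (κ n : ℂ) ^ 2)⁻¹ * ℓ n x := by
  obtain ⟨hz0, hzφ⟩ := hz
  have harg : |z.arg| < Real.pi := hzφ.trans hφ
  have hzn : 0 < ‖z‖ := norm_pos_iff.2 hz0
  -- Principal square root: its argument is arg z / 2, so Re μ ≥ |z|^{1/2} cos(φ/2) > 0.
  set μ : ℂ := z ^ ((2 : ℕ)⁻¹ : ℂ) with hμd
  have hμ2 : μ ^ 2 = z := Complex.cpow_nat_inv_pow z two_ne_zero
  have hμre : μ.re = ‖z‖ ^ (2⁻¹ : ℝ) * Real.cos (z.arg / 2) := by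
    rw [hμd, Complex.cpow_def_of_ne_zero hz0, Complex.exp_re, Real.rpow_def_of_pos hzn]
    have h1 : (Complex.log z * ((2 : ℕ) : ℂ)⁻¹).re = Real.log ‖z‖ * 2⁻¹ := by
      rw [show (((2 : ℕ) : ℂ)⁻¹) = ((2⁻¹ : ℝ) : ℂ) by simp, Complex.re_mul_ofReal, Complex.log_re]
    have h2 : (Complex.log z * ((2 : ℕ) : ℂ)⁻¹).im = z.arg / 2 := by
      rw [show (((2 : ℕ) : ℂ)⁻¹) = ((2⁻¹ : ℝ) : ℂ) by simp, Complex.im_mul_ofReal, Complex.log_im]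
      ring
    rw [h1, h2]
  have hcosφ : 0 < Real.cos (φ / 2) :=
    Real.cos_pos_of_mem_Ioo ⟨by linarith [abs_nonneg z.arg, Real.pi_pos], by linarith⟩
  have hcos : Real.cos (φ / 2) ≤ Real.cos (z.arg / 2) := by
    rw [← Real.cos_abs (z.arg / 2), abs_div, abs_two]
    exact Real.cos_le_cos_of_nonneg_of_le_pi (by positivity) (by linarith [Real.pi_pos])
      (by linarith)
  have hs : (‖z‖ ^ (2⁻¹ : ℝ)) ^ 2 = ‖z‖ := by
    rw [← Real.rpow_natCast, ← Real.rpow_mul hzn.le]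
    norm_num
  have hspos : 0 < ‖z‖ ^ (2⁻¹ : ℝ) := Real.rpow_pos_of_pos hzn _
  have hμpos : 0 < μ.re := hμre ▸ mul_pos hspos (hcosφ.trans_le hcos)
  -- The symbol of z - D² factors into the symbols of μ - D and μ + D.
  have hfac : ∀ n, z + (κ n : ℂ) ^ 2 = (μ - Complex.I * κ n) * (μ - Complex.I * (-κ n : ℝ)) :=
    fun n => by
      push_cast
      linear_combination -hμ2 + (κ n : ℂ) ^ 2 * Complex.I_sq
  have hne : ∀ y : ℝ, μ - Complex.I * y ≠ 0 := fun y h => by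
    have := congrArg Complex.re h
    simp at this
    exact hμpos.ne' this
  obtain ⟨J, hJ, hJe⟩ := hG.exists_laplace hμpos
  obtain ⟨K, hK, hKe⟩ := hG.reverse.exists_laplace hμpos
  refine ⟨fun n => hfac n ▸ mul_ne_zero (hne _) (hne _), J.comp K, ?_, fun n x => ?_⟩
  · have hM := hG.bound_nonneg
    calc ‖z‖ * ‖J.comp K‖ ≤ ‖z‖ * ((M * μ.re⁻¹) * (M * μ.re⁻¹)) := by
          gcongr
          exact (J.opNorm_comp_le K).trans (by gcongr)
      _ = M ^ 2 / Real.cos (z.arg / 2) ^ 2 := by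
          have := (hcosφ.trans_le hcos).ne'
          rw [hμre]
          nth_rewrite 1 [← hs]
          field_simp
      _ ≤ _ := by gcongr
  · rw [ContinuousLinearMap.comp_apply, hJe, hKe, hfac, mul_inv]
    ring

/-- A bounded operator with symbol `1 / κ²`, for a group that is periodic up to the
factor `η ≠ 1`. -/
theorem exists_inverse [CompleteSpace X] (hG : IsDiagonalGroup M G κ ℓ) {η : ℂ} (hη : η ≠ 1)
    (hκ : ∀ n, Complex.exp (Complex.I * κ n * 2) = η) :
    (∀ n, (0 : ℂ) + (κ n : ℂ) ^ 2 ≠ 0) ∧ ∃ R : X →L[ℂ] X,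
      ∀ n x, ℓ n (R x) = (0 + (κ n : ℂ) ^ 2)⁻¹ * ℓ n x := by
  have hκ0 : ∀ n, (κ n : ℂ) ≠ 0 := fun n h => hη (by rw [← hκ n, h]; simp)
  refine ⟨fun n => by simpa using hκ0 n, ?_⟩
  -- Integrating e^{iκs} over one period gives (η - 1)/(iκ), a fixed nonzero multiple of the symbol
  -- of D⁻¹.
  set k : ℝ → ℂ := (Ioc (0 : ℝ) 2).indicator fun _ => 1 with hk
  have hki : Integrable k := by
    rw [hk, integrable_indicator_iff measurableSet_Ioc]
    simp
  have key : ∀ n x, ℓ n (hG.average k x) = (η - 1) / (Complex.I * κ n) * ℓ n x := fun n x => by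
    rw [hG.eigen_average hki]
    congr 1
    have : ∀ s : ℝ, Complex.exp (Complex.I * κ n * s) * k s
        = (Ioc (0 : ℝ) 2).indicator
          (fun s : ℝ => Complex.exp (Complex.I * κ n * s)) s := fun s => by
      rw [hk]
      by_cases hs : s ∈ Ioc (0 : ℝ) 2 <;> simp [hs]
    simp only [this]
    rw [integral_indicator measurableSet_Ioc, ← intervalIntegral.integral_of_le (by norm_num),
      integral_exp_mul_complex (mul_ne_zero Complex.I_ne_zero (hκ0 n))]
    push_cast
    rw [hκ n]
    simp
  -- The minus sign compensates (iκ)² = -κ².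
  refine ⟨(-((η - 1) ^ 2)⁻¹) • (hG.average k).comp (hG.average k), fun n x => ?_⟩
  have h1 := sub_ne_zero.2 hη
  have h2 := hκ0 n
  have h3 := Complex.I_ne_zero
  simp only [smul_apply, ContinuousLinearMap.comp_apply, map_smul, key,
    smul_eq_mul, zero_add]
  field_simp
  simp

end IsDiagonalGroup

end DiagonalGroup

/-! ### The analytic semigroup generated by the squared generator. -/

section DiagonalGroup

variable {X : Type*} [NormedAddCommGroup X] [NormedSpace ℂ X] {ι : Type*}

namespace IsDiagonalGroup

variable {M : ℝ} {G : ℝ → X →L[ℂ] X} {κ : ι → ℝ} {ℓ : ι → X →L[ℂ] ℂ}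

/-- An operator whose symbol is `1 / (z + κ²)` is a two-sided inverse of `z - A`, if `A` has symbol
`-κ²`. -/
theorem resolvent_spec (hG : IsDiagonalGroup M G κ ℓ) {A : X →ₗ.[ℂ] X}
    (hA : ∀ x y, (x, y) ∈ A.graph ↔ ∀ n, ℓ n y = -(κ n : ℂ) ^ 2 * ℓ n x) {z : ℂ}
    (hz : ∀ n, z + (κ n : ℂ) ^ 2 ≠ 0) {R : X →L[ℂ] X}
    (hR : ∀ n x, ℓ n (R x) = (z + (κ n : ℂ) ^ 2)⁻¹ * ℓ n x) :
    (∀ f : X, ∃ u : A.domain, (u : X) = R f ∧ z • (u : X) - A u = f) ∧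
      ∀ u : A.domain, R (z • (u : X) - A u) = u := by
  constructor
  · intro f
    have h : (R f, z • R f - f) ∈ A.graph := (hA _ _).2 fun n => by
      have := hz n
      rw [map_sub, map_smul, hR, smul_eq_mul]
      field_simp
      ring
    obtain ⟨u, hu, hAu⟩ := (LinearPMap.mem_graph_iff A).1 h
    exact ⟨u, hu, by rw [hAu, hu, sub_sub_cancel]⟩
  · intro u
    refine hG.ext fun n => ?_
    have := hz n
    rw [hR, map_sub, map_smul, (hA _ _).1 (A.mem_graph u) n, smul_eq_mul]
    field_simp
    ring

theorem integrable_gaussian {b : ℂ} (hb : 0 < b.re) :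
    Integrable fun s : ℝ => Complex.exp (-b * (s : ℂ) ^ 2) :=
  integrable_cexp_neg_mul_sq hb

theorem integrable_pow_mul_gaussian {β : ℝ} (hβ : 0 < β) (m : ℕ) :
    Integrable fun s : ℝ => s ^ m * Real.exp (-β * s ^ 2) := by
  simpa using integrable_rpow_mul_exp_neg_mul_sq hβ (s := m) (by linarith [m.cast_nonneg (α := ℝ)])

theorem integrable_sq_mul_gaussian {b : ℂ} (hb : 0 < b.re) :
    Integrable fun s : ℝ => (s : ℂ) ^ 2 * Complex.exp (-b * (s : ℂ) ^ 2) := by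
  refine (integrable_pow_mul_gaussian hb 2).mono (by fun_prop) (Eventually.of_forall fun s => ?_)
  rw [norm_mul, norm_mul, norm_cexp_neg_mul_sq, norm_pow, norm_pow, Complex.norm_real,
    Real.norm_of_nonneg (Real.exp_pos _).le]

theorem norm_exp_sub_one_sub_id_le_exp (w : ℂ) :
    ‖Complex.exp w - 1 - w‖ ≤ ‖w‖ ^ 2 * Real.exp ‖w‖ := by
  have := Complex.norm_exp_sub_sum_le_norm_mul_exp w 2
  simpa [Finset.sum_range_succ, sub_sub] using this

/-- Second-order Taylor bound in the parameter b. Half of the Gaussian decay absorbs the growth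
e^{|h|s²} of the remainder, which leaves a majorant integrable in s. -/
theorem norm_gaussian_remainder_le (b h : ℂ) (s : ℝ) (hh : ‖h‖ ≤ b.re / 2) :
    ‖Complex.exp (-(b + h) * (s : ℂ) ^ 2) - Complex.exp (-b * (s : ℂ) ^ 2)
        - -h * ((s : ℂ) ^ 2 * Complex.exp (-b * (s : ℂ) ^ 2))‖
      ≤ ‖h‖ ^ 2 * (s ^ 4 * Real.exp (-(b.re / 2) * s ^ 2)) := by
  have e : Complex.exp (-(b + h) * (s : ℂ) ^ 2) - Complex.exp (-b * (s : ℂ) ^ 2)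
        - -h * ((s : ℂ) ^ 2 * Complex.exp (-b * (s : ℂ) ^ 2))
      = Complex.exp (-b * (s : ℂ) ^ 2) * (Complex.exp (-h * (s : ℂ) ^ 2) - 1 - -h * (s : ℂ) ^ 2) := by
    rw [show -(b + h) * (s : ℂ) ^ 2 = -b * (s : ℂ) ^ 2 + -h * (s : ℂ) ^ 2 by ring, Complex.exp_add]
    ring
  have hw : ‖-h * (s : ℂ) ^ 2‖ = ‖h‖ * s ^ 2 := by
    rw [norm_mul, norm_neg, norm_pow, Complex.norm_real, Real.norm_eq_abs, sq_abs]
  rw [e, norm_mul, norm_cexp_neg_mul_sq]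
  calc _ ≤ Real.exp (-b.re * s ^ 2) * ((‖h‖ * s ^ 2) ^ 2 * Real.exp (‖h‖ * s ^ 2)) := by
        gcongr
        exact hw ▸ norm_exp_sub_one_sub_id_le_exp _
    _ = ‖h‖ ^ 2 * (s ^ 4 * Real.exp (-b.re * s ^ 2 + ‖h‖ * s ^ 2)) := by
        rw [Real.exp_add]
        ring
    _ ≤ _ := by
        gcongr
        nlinarith [sq_nonneg s]

/-- The L¹ norm of a kernel controls the operator norm of its average, so an L¹ remainder of order
|h|² gives differentiability in operator norm. -/
theorem hasDerivAt_average_gaussian (hG : IsDiagonalGroup M G κ ℓ) {b : ℂ} (hb : 0 < b.re) :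
    HasDerivAt (fun b : ℂ => hG.average fun s => Complex.exp (-b * (s : ℂ) ^ 2))
      (-hG.average fun s => (s : ℂ) ^ 2 * Complex.exp (-b * (s : ℂ) ^ 2)) b := by
  rw [hasDerivAt_iff_isLittleO_nhds_zero]
  refine Asymptotics.IsBigO.trans_isLittleO (g := fun h : ℂ => h ^ 2) ?_
    (by simpa using Asymptotics.isLittleO_pow_id (𝕜 := ℂ) one_lt_two)
  set C := M * ∫ s : ℝ, s ^ 4 * Real.exp (-(b.re / 2) * s ^ 2)
  refine Asymptotics.IsBigO.of_bound C ?_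
  filter_upwards [Metric.ball_mem_nhds (0 : ℂ) (half_pos hb)] with h hh
  have hh' : ‖h‖ < b.re / 2 := by simpa using hh
  have hbh : 0 < (b + h).re := by
    have := (abs_lt.1 ((Complex.abs_re_le_norm h).trans_lt hh')).1
    rw [Complex.add_re]
    linarith
  have i1 := integrable_gaussian hbh
  have i2 := integrable_gaussian hb
  have i3 := integrable_sq_mul_gaussian hb
  have i12 : Integrable fun s : ℝ => Complex.exp (-(b + h) * (s : ℂ) ^ 2)
      - Complex.exp (-b * (s : ℂ) ^ 2) := i1.sub i2
  rw [smul_neg, ← neg_smul, ← hG.average_sub i1 i2, ← hG.average_const_mul _ i3,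
    ← hG.average_sub i12 (i3.const_mul _)]
  have i4 := integrable_pow_mul_gaussian (half_pos hb) 4
  calc _ ≤ M * ∫ s : ℝ, ‖Complex.exp (-(b + h) * (s : ℂ) ^ 2) - Complex.exp (-b * (s : ℂ) ^ 2)
        - -h * ((s : ℂ) ^ 2 * Complex.exp (-b * (s : ℂ) ^ 2))‖ :=
        hG.norm_average_le (i12.sub (i3.const_mul _))
    _ ≤ M * ∫ s : ℝ, ‖h‖ ^ 2 * (s ^ 4 * Real.exp (-(b.re / 2) * s ^ 2)) := by
        refine mul_le_mul_of_nonneg_left ?_ hG.bound_nonneg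
        exact integral_mono (i12.sub (i3.const_mul _)).norm (i4.const_mul _)
          fun s => norm_gaussian_remainder_le b h s hh'.le
    _ = C * ‖h ^ 2‖ := by
        rw [integral_const_mul, norm_pow]
        ring

/-- The semigroup `exp (z D²)` as a Gaussian average of the group `exp (s D)`. -/
def heat (hG : IsDiagonalGroup M G κ ℓ) (z : ℂ) : X →L[ℂ] X :=
  if z = 0 then ContinuousLinearMap.id ℂ X else
    -- With b = (4z)⁻¹, the mass of e^{-bs²} is (π/b)^{1/2}; this normalises the kernel to mass 1.
    ((Real.pi / (4 * z)⁻¹ : ℂ) ^ (1 / 2 : ℂ))⁻¹ •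
      hG.average fun s => Complex.exp (-(4 * z)⁻¹ * (s : ℂ) ^ 2)

theorem inv_four_mul_re_pos {z : ℂ} (hz : 0 < z.re) : 0 < ((4 * z)⁻¹).re := by
  have h0 : z ≠ 0 := fun h => by simp [h] at hz
  rw [Complex.inv_re]
  have : 0 < (4 * z).re := by simpa using hz
  exact div_pos this (Complex.normSq_pos.2 (by simpa using h0))

theorem sector_pi_div_two : sector (Real.pi / 2) = {z | 0 < z.re} := by
  ext z
  simp only [sector, mem_ofPred_eq, Complex.abs_arg_lt_pi_div_two_iff]
  constructor
  · rintro ⟨h, h1 | h1⟩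
    · exact h1
    · exact absurd h1 h
  · intro h
    exact ⟨fun h0 => by simp [h0] at h, Or.inl h⟩

theorem heat_of_re_pos (hG : IsDiagonalGroup M G κ ℓ) {z : ℂ} (hz : 0 < z.re) :
    hG.heat z = ((Real.pi / (4 * z)⁻¹ : ℂ) ^ (1 / 2 : ℂ))⁻¹ •
      hG.average fun s => Complex.exp (-(4 * z)⁻¹ * (s : ℂ) ^ 2) :=
  if_neg fun h => by simp [h] at hz

/-- The Fourier transform of a normalised Gaussian is e^{-κ²/(4b)}, and b = (4z)⁻¹. -/
theorem eigen_heat [CompleteSpace X] (hG : IsDiagonalGroup M G κ ℓ) {z : ℂ}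
    (hz : 0 < z.re ∨ z = 0) (n : ι) (x : X) :
    ℓ n (hG.heat z x) = Complex.exp (-z * (κ n : ℂ) ^ 2) * ℓ n x := by
  rcases hz with hz | rfl
  · have h0 : z ≠ 0 := fun h => by simp [h] at hz
    have hc : (Real.pi / (4 * z)⁻¹ : ℂ) ^ (1 / 2 : ℂ) ≠ 0 := by
      simp [Complex.cpow_eq_zero_iff, h0]
    rw [hG.heat_of_re_pos hz, smul_apply, map_smul,
      hG.eigen_average (integrable_gaussian (inv_four_mul_re_pos hz)),
      fourierIntegral_gaussian (inv_four_mul_re_pos hz), smul_eq_mul, ← mul_assoc, ← mul_assoc,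
      inv_mul_cancel₀ hc, one_mul]
    congr 2
    field_simp
  · simp [heat]

theorem differentiableOn_heat (hG : IsDiagonalGroup M G κ ℓ) :
    DifferentiableOn ℂ hG.heat (sector (Real.pi / 2)) := by
  rw [sector_pi_div_two]
  intro z hz
  have hz : 0 < z.re := hz
  have h0 : z ≠ 0 := fun h => by simp [h] at hz
  have h40 : 4 * z ≠ 0 := by simpa using h0
  have hinv : DifferentiableAt ℂ (fun z : ℂ => (4 * z)⁻¹) z :=
    (differentiableAt_id.const_mul 4).inv h40
  have hev : hG.heat =ᶠ[𝓝 z] fun z => ((Real.pi / (4 * z)⁻¹ : ℂ) ^ (1 / 2 : ℂ))⁻¹ •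
      hG.average fun s => Complex.exp (-(4 * z)⁻¹ * (s : ℂ) ^ 2) := by
    filter_upwards [(isOpen_lt continuous_const Complex.continuous_re).mem_nhds hz] with w hw
    exact hG.heat_of_re_pos hw
  refine DifferentiableAt.differentiableWithinAt ?_
  refine DifferentiableAt.congr_of_eventuallyEq ?_ hev
  -- The base of the power is 4πz, which has positive real part and so avoids the branch cut.
  have hsl : (Real.pi / (4 * z)⁻¹ : ℂ) ∈ Complex.slitPlane := by
    rw [div_inv_eq_mul, Complex.mem_slitPlane_iff]
    left
    rw [Complex.re_ofReal_mul]
    have : 0 < (4 * z).re := by simpa using hz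
    exact mul_pos Real.pi_pos this
  refine DifferentiableAt.smul (DifferentiableAt.inv (DifferentiableAt.cpow
    ((differentiableAt_const _).div hinv (inv_ne_zero h40)) (differentiableAt_const _) hsl) ?_) ?_
  · simp [Complex.cpow_eq_zero_iff, h0]
  · exact (hG.hasDerivAt_average_gaussian (inv_four_mul_re_pos hz)).differentiableAt.comp z hinv

theorem heat_add [CompleteSpace X] (hG : IsDiagonalGroup M G κ ℓ) {z w : ℂ} (hz : 0 < z.re)
    (hw : 0 < w.re) : hG.heat (z + w) = (hG.heat z).comp (hG.heat w) := by
  ext x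
  refine hG.ext fun n => ?_
  rw [ContinuousLinearMap.comp_apply, hG.eigen_heat (Or.inl hz), hG.eigen_heat (Or.inl hw),
    hG.eigen_heat (Or.inl (by rw [Complex.add_re]; linarith)), ← mul_assoc, ← Complex.exp_add]
  congr 2
  ring

/-- Mass 1 lets x be moved under the integral. The rescaling s = rσ is free here; r = |z|^{1/2} will
make the kernels uniformly dominated as z → 0. -/
theorem heat_sub_eq_integral [CompleteSpace X] (hG : IsDiagonalGroup M G κ ℓ) {z : ℂ}
    (hz : 0 < z.re) {r : ℝ} (hr : 0 < r) (x : X) :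
    hG.heat z x - x = ∫ σ : ℝ, (r * ((Real.pi / (4 * z)⁻¹ : ℂ) ^ (1 / 2 : ℂ))⁻¹ *
      Complex.exp (-(4 * z)⁻¹ * ((r * σ : ℝ) : ℂ) ^ 2)) • (G (r * σ) x - x) := by
  have h0 : z ≠ 0 := fun h => by simp [h] at hz
  have hc : (Real.pi / (4 * z)⁻¹ : ℂ) ^ (1 / 2 : ℂ) ≠ 0 := by
    simp [Complex.cpow_eq_zero_iff, h0]
  set c := (Real.pi / (4 * z)⁻¹ : ℂ) ^ (1 / 2 : ℂ) with hcd
  have hg := integrable_gaussian (inv_four_mul_re_pos hz)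
  have hone : c⁻¹ * ∫ s : ℝ, Complex.exp (-(4 * z)⁻¹ * (s : ℂ) ^ 2) = 1 := by
    rw [integral_gaussian_complex (inv_four_mul_re_pos hz), inv_mul_cancel₀ hc]
  have e1 : hG.heat z x - x
      = c⁻¹ • ∫ s : ℝ, Complex.exp (-(4 * z)⁻¹ * (s : ℂ) ^ 2) • (G s x - x) := by
    simp only [smul_sub]
    rw [integral_sub (hG.integrable_smul hg x) (hg.smul_const x), integral_smul_const, smul_sub,
      smul_smul, hone, one_smul, hG.heat_of_re_pos hz, smul_apply, hG.average_apply hg]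
  have e2 := Measure.integral_comp_mul_left
    (fun s : ℝ => Complex.exp (-(4 * z)⁻¹ * (s : ℂ) ^ 2) • (G s x - x)) r
  rw [e1]
  simp only [mul_smul]
  rw [integral_smul, integral_smul, e2, abs_of_pos (inv_pos.2 hr), Complex.coe_smul, smul_comm c⁻¹,
    smul_smul, mul_inv_cancel₀ hr.ne', one_smul]

/-- After rescaling by |z|^{1/2}, one Gaussian dominates the kernels for all z in the sector, while
G(|z|^{1/2}σ)x → x for each σ; dominated convergence concludes. -/
theorem tendsto_heat_zero [CompleteSpace X] (hG : IsDiagonalGroup M G κ ℓ) {δ : ℝ}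
    (hδ0 : 0 < δ) (hδ : δ < Real.pi / 2) (x : X) :
    Tendsto (fun z => hG.heat z x) (𝓝[sector δ] 0) (𝓝 x) := by
  rw [tendsto_iff_norm_sub_tendsto_zero]
  have hcos : 0 < Real.cos δ / 4 := by
    have := Real.cos_pos_of_mem_Ioo (x := δ) ⟨by linarith, hδ⟩
    positivity
  set K : ℝ := ((Real.pi * 4) ^ (1 / 2 : ℝ))⁻¹ with hK
  have hsec : ∀ z ∈ sector δ, 0 < z.re := fun z hz => by
    have : z ∈ sector (Real.pi / 2) := ⟨hz.1, hz.2.trans hδ⟩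
    rwa [sector_pi_div_two] at this
  have hker : ∀ z ∈ sector δ, ∀ σ : ℝ,
      ‖((‖z‖ ^ (1 / 2 : ℝ) : ℝ) * ((Real.pi / (4 * z)⁻¹ : ℂ) ^ (1 / 2 : ℂ))⁻¹ *
        Complex.exp (-(4 * z)⁻¹ * ((‖z‖ ^ (1 / 2 : ℝ) * σ : ℝ) : ℂ) ^ 2))‖
      ≤ K * Real.exp (-(Real.cos δ / 4) * σ ^ 2) := by
    intro z hz σ
    have hzn : 0 < ‖z‖ := norm_pos_iff.2 hz.1
    have hrp : 0 < ‖z‖ ^ (1 / 2 : ℝ) := Real.rpow_pos_of_pos hzn _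
    have hr2 : (‖z‖ ^ (1 / 2 : ℝ)) ^ 2 = ‖z‖ := by
      rw [← Real.rpow_natCast, ← Real.rpow_mul hzn.le]
      norm_num
    have hc : ‖(Real.pi / (4 * z)⁻¹ : ℂ) ^ (1 / 2 : ℂ)‖
        = (Real.pi * 4) ^ (1 / 2 : ℝ) * ‖z‖ ^ (1 / 2 : ℝ) := by
      rw [show (1 / 2 : ℂ) = ((1 / 2 : ℝ) : ℂ) by push_cast; ring, Complex.norm_cpow_real,
        div_inv_eq_mul, norm_mul, norm_mul, Complex.norm_real, Real.norm_of_nonneg Real.pi_pos.le,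
        ← mul_assoc, Real.mul_rpow (by positivity) (norm_nonneg _)]
      norm_num
    rw [norm_mul, norm_mul, norm_inv, hc, Complex.norm_real, Real.norm_of_nonneg hrp.le,
      norm_cexp_neg_mul_sq, hK]
    have hcosz : Real.cos δ ≤ Real.cos z.arg := by
      rw [← Real.cos_abs z.arg]
      exact Real.cos_le_cos_of_nonneg_of_le_pi (abs_nonneg _) (by linarith [Real.pi_pos]) hz.2.le
    have hre : z.re = ‖z‖ * Real.cos z.arg := (Complex.norm_mul_cos_arg z).symm
    -- The rescaled decay rate depends only on arg z, hence is at least cos δ / 4 on the sector.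
    have h4 : ((4 * z)⁻¹).re * ‖z‖ = Real.cos z.arg / 4 := by
      rw [Complex.inv_re, Complex.normSq_eq_norm_sq, norm_mul, Complex.mul_re, hre]
      norm_num
      field_simp
      norm_num
    have hexp : -((4 * z)⁻¹).re * (‖z‖ ^ (1 / 2 : ℝ) * σ) ^ 2 ≤ -(Real.cos δ / 4) * σ ^ 2 := by
      rw [mul_pow, hr2, ← mul_assoc, neg_mul, h4]
      nlinarith [sq_nonneg σ]
    refine mul_le_mul (le_of_eq ?_) (Real.exp_le_exp.2 hexp) (Real.exp_pos _).le (by positivity)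
    field_simp
  have hKnn : 0 ≤ K := by positivity
  have hlim : Tendsto (fun z : ℂ => ‖z‖ ^ (1 / 2 : ℝ)) (𝓝[sector δ] 0) (𝓝 0) := by
    have : Tendsto (fun z : ℂ => ‖z‖ ^ (1 / 2 : ℝ)) (𝓝 0) (𝓝 (‖(0 : ℂ)‖ ^ (1 / 2 : ℝ))) :=
      (continuous_norm.tendsto (0 : ℂ)).rpow_const (Or.inr (by norm_num))
    rw [norm_zero, Real.zero_rpow (by norm_num)] at this
    exact this.mono_left nhdsWithin_le_nhds
  have hint : Tendsto (fun z : ℂ => ∫ σ : ℝ, K * Real.exp (-(Real.cos δ / 4) * σ ^ 2) *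
      ‖G (‖z‖ ^ (1 / 2 : ℝ) * σ) x - x‖) (𝓝[sector δ] 0) (𝓝 (∫ _ : ℝ, (0 : ℝ))) := by
    refine tendsto_integral_filter_of_dominated_convergence
      (fun σ => K * Real.exp (-(Real.cos δ / 4) * σ ^ 2) * (M * ‖x‖ + ‖x‖)) ?_ ?_ ?_ ?_
    · refine Eventually.of_forall fun z => Continuous.aestronglyMeasurable ?_
      exact (by fun_prop : Continuous fun σ : ℝ => K * Real.exp (-(Real.cos δ / 4) * σ ^ 2)).mul
        ((((hG.continuous x).comp (continuous_const.mul continuous_id)).sub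
          continuous_const).norm)
    · refine Eventually.of_forall fun z => Eventually.of_forall fun σ => ?_
      rw [Real.norm_of_nonneg (by positivity)]
      gcongr
      exact (norm_sub_le _ _).trans (by gcongr; exact hG.norm_apply_le _ _)
    · exact ((integrable_exp_neg_mul_sq hcos).const_mul K).mul_const _
    · refine Eventually.of_forall fun σ => ?_
      have h1 : Tendsto (fun z : ℂ => G (‖z‖ ^ (1 / 2 : ℝ) * σ) x) (𝓝[sector δ] 0) (𝓝 (G 0 x)) :=
        ((hG.continuous x).tendsto 0).comp (by simpa using hlim.mul_const σ)
      rw [hG.map_zero] at h1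
      have := (tendsto_iff_norm_sub_tendsto_zero.1 h1).const_mul
        (K * Real.exp (-(Real.cos δ / 4) * σ ^ 2))
      simpa using this
  rw [integral_zero] at hint
  refine squeeze_zero' (Eventually.of_forall fun _ => norm_nonneg _) ?_ hint
  filter_upwards [self_mem_nhdsWithin] with z hz
  have hzn : 0 < ‖z‖ := norm_pos_iff.2 hz.1
  rw [hG.heat_sub_eq_integral (hsec z hz) (Real.rpow_pos_of_pos hzn (1 / 2)) x]
  refine norm_integral_le_of_norm_le ?_ (Eventually.of_forall fun σ => ?_)
  · refine (((integrable_exp_neg_mul_sq hcos).const_mul K).mul_const (M * ‖x‖ + ‖x‖)).mono'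
      (Continuous.aestronglyMeasurable ?_) (Eventually.of_forall fun σ => ?_)
    · exact (by fun_prop : Continuous fun σ : ℝ => K * Real.exp (-(Real.cos δ / 4) * σ ^ 2)).mul
        ((((hG.continuous x).comp (continuous_const.mul continuous_id)).sub
          continuous_const).norm)
    · rw [Real.norm_of_nonneg (by positivity)]
      gcongr
      exact (norm_sub_le _ _).trans (by gcongr; exact hG.norm_apply_le _ _)
  · rw [norm_smul]
    exact mul_le_mul_of_nonneg_right (hker z hz σ) (norm_nonneg _)

theorem isAnalyticSemigroup_heat [CompleteSpace X] (hG : IsDiagonalGroup M G κ ℓ) :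
    IsAnalyticSemigroup (Real.pi / 2) hG.heat where
  map_zero := if_pos rfl
  map_add z hz w hw := by
    rw [sector_pi_div_two] at hz hw
    exact hG.heat_add hz hw
  holomorphic := hG.differentiableOn_heat
  continuous_zero _ h0 h x := hG.tendsto_heat_zero h0 h x

theorem continuousOn_heat [CompleteSpace X] (hG : IsDiagonalGroup M G κ ℓ) (x : X) :
    ContinuousOn (fun t : ℝ => hG.heat t x) (Ici 0) := by
  intro t ht
  rcases (mem_Ici.1 ht).eq_or_lt with rfl | ht
  · rw [← Ioi_insert, continuousWithinAt_insert_self]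
    -- Any angle in (0, π/2) would do, since only positive reals are used.
    have h := hG.tendsto_heat_zero (δ := 1) one_pos (by linarith [Real.pi_gt_three]) x
    have h0 : hG.heat ((0 : ℝ) : ℂ) x = x := by simp [heat]
    rw [ContinuousWithinAt, h0]
    refine h.comp (tendsto_nhdsWithin_iff.2 ⟨?_, ?_⟩)
    · exact (Complex.continuous_ofReal.tendsto' 0 0 rfl).mono_left nhdsWithin_le_nhds
    · filter_upwards [self_mem_nhdsWithin] with s hs
      have hs : (0 : ℝ) < s := hs
      exact ⟨by exact_mod_cast hs.ne', by rw [Complex.arg_ofReal_of_nonneg hs.le]; simp⟩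
  · have hmem : (t : ℂ) ∈ sector (Real.pi / 2) := by
      rw [sector_pi_div_two]
      simpa using ht
    have hopen : IsOpen (sector (Real.pi / 2)) := by
      rw [sector_pi_div_two]
      exact isOpen_lt continuous_const Complex.continuous_re
    have h := (hG.differentiableOn_heat.differentiableAt (hopen.mem_nhds hmem)).continuousAt
    have h2 : ContinuousAt (fun s : ℝ => hG.heat s) t :=
      ContinuousAt.comp (f := fun s : ℝ => (s : ℂ)) h Complex.continuous_ofReal.continuousAt
    exact (h2.clm_apply continuousAt_const).continuousWithinAt

/-- Applying ℓ n reduces the claim to the fundamental theorem of calculus for e^{-rκ²}. -/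
theorem heat_sub_eq_intervalIntegral [CompleteSpace X] (hG : IsDiagonalGroup M G κ ℓ) {x y : X}
    (hxy : ∀ n, ℓ n y = -(κ n : ℂ) ^ 2 * ℓ n x) {t : ℝ} (ht : 0 ≤ t) :
    hG.heat t x - x = ∫ r in (0 : ℝ)..t, hG.heat r y := by
  have hcont : ContinuousOn (fun r : ℝ => hG.heat r y) (uIcc 0 t) :=
    (hG.continuousOn_heat y).mono (by rw [uIcc_of_le ht]; exact fun _ h => h.1)
  have hpos : ∀ r : ℝ, 0 ≤ r → 0 < (r : ℂ).re ∨ (r : ℂ) = 0 := fun r hr => by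
    rcases hr.eq_or_lt with rfl | hr
    · exact Or.inr rfl
    · exact Or.inl (by simpa using hr)
  refine hG.ext fun n => ?_
  rw [← ContinuousLinearMap.intervalIntegral_comp_comm _ hcont.intervalIntegrable,
    map_sub, hG.eigen_heat (hpos t ht)]
  have hderiv : ∀ r : ℝ, HasDerivAt (fun r : ℝ => Complex.exp (-(r : ℂ) * (κ n : ℂ) ^ 2) * ℓ n x)
      (Complex.exp (-(r : ℂ) * (κ n : ℂ) ^ 2) * (-(κ n : ℂ) ^ 2 * ℓ n x)) r := fun r => by
    have h1 : HasDerivAt (fun r : ℝ => -(r : ℂ) * (κ n : ℂ) ^ 2) (-1 * (κ n : ℂ) ^ 2) r :=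
      ((Complex.ofRealCLM.hasDerivAt (x := r)).neg).mul_const _
    convert! (h1.cexp).mul_const (ℓ n x) using 1
    ring
  have hint : ∀ r ∈ uIcc 0 t, ℓ n (hG.heat r y)
      = Complex.exp (-(r : ℂ) * (κ n : ℂ) ^ 2) * (-(κ n : ℂ) ^ 2 * ℓ n x) := fun r hr => by
    rw [uIcc_of_le ht] at hr
    rw [hG.eigen_heat (hpos r hr.1), hxy]
  rw [intervalIntegral.integral_congr hint,
    intervalIntegral.integral_eq_sub_of_hasDerivAt (fun r _ => hderiv r)
      (Continuous.intervalIntegrable (by fun_prop) _ _)]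
  simp

/-- On the graph, the difference quotient is a mean of the continuous orbit of y. Conversely, ℓ n of
the quotient tends both to ℓ n y and to the scalar derivative -κ²ℓ n x. -/
theorem isGenerator_heat [CompleteSpace X] (hG : IsDiagonalGroup M G κ ℓ) {A : X →ₗ.[ℂ] X}
    (hA : ∀ x y, (x, y) ∈ A.graph ↔ ∀ n, ℓ n y = -(κ n : ℂ) ^ 2 * ℓ n x) :
    IsGenerator A hG.heat := by
  intro x y
  rw [hA]
  constructor
  · intro hxy
    have h0 : hG.heat ((0 : ℝ) : ℂ) y = y := by simp [heat]
    have hc := hG.continuousOn_heat y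
    have hd := intervalIntegral.integral_hasDerivWithinAt_right
      (f := fun r : ℝ => hG.heat r y) (a := 0) (b := 0) (s := Ici 0) (t := Ioi 0) (by simp)
      ((hc.mono Ioi_subset_Ici_self).stronglyMeasurableAtFilter_nhdsWithin measurableSet_Ioi 0)
      ((hc 0 self_mem_Ici).mono Ioi_subset_Ici_self)
    replace hd := hd.mono Ioi_subset_Ici_self
    rw [h0, hasDerivWithinAt_iff_tendsto_slope' (by simp)] at hd
    refine hd.congr' ?_
    filter_upwards [self_mem_nhdsWithin] with t ht
    have ht : (0 : ℝ) < t := ht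
    rw [hG.heat_sub_eq_intervalIntegral hxy ht.le, slope_def_module, sub_zero,
      intervalIntegral.integral_same, sub_zero, ← Complex.ofReal_inv, Complex.coe_smul]
  · intro h n
    have h1 := ((ℓ n).continuous.tendsto y).comp h
    have h2 : HasDerivAt (fun r : ℝ => Complex.exp (-(r : ℂ) * (κ n : ℂ) ^ 2) * ℓ n x)
        (-(κ n : ℂ) ^ 2 * ℓ n x) 0 := by
      have h1 : HasDerivAt (fun r : ℝ => -(r : ℂ) * (κ n : ℂ) ^ 2) (-1 * (κ n : ℂ) ^ 2) 0 :=
        ((Complex.ofRealCLM.hasDerivAt (x := 0)).neg).mul_const _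
      convert! (h1.cexp).mul_const (ℓ n x) using 1
      simp
    have h3 := h2.tendsto_slope_zero_right
    refine tendsto_nhds_unique h1 (h3.congr' ?_)
    filter_upwards [self_mem_nhdsWithin] with t ht
    have ht : (0 : ℝ) < t := ht
    simp only [Function.comp_apply, map_smul, map_sub]
    rw [hG.eigen_heat (Or.inl (by simpa using ht)), zero_add, ← Complex.coe_smul]
    simp

end IsDiagonalGroup

end DiagonalGroup

/-! ### Weak derivatives, primitives and integration by parts on the interval. -/

section Calculus

theorem integral_Ioc_eq_setIntegral_Iic {g : ℝ → ℂ} {x : ℝ} (hx : x ∈ I) :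
    ∫ y in (-1 : ℝ)..x, g y = ∫ y in Iic x, g y ∂(volume.restrict I) := by
  rw [intervalIntegral.integral_of_le hx.1.le, Measure.restrict_restrict measurableSet_Iic]
  congr 2
  ext y
  simp only [mem_Ioc, mem_inter_iff, mem_Iic, mem_Ioo]
  exact ⟨fun h => ⟨h.2, h.1, h.2.trans_lt hx.2⟩, fun h => ⟨h.2.1, h.1⟩⟩

theorem integral_I_eq_intervalIntegral (g : ℝ → ℂ) : ∫ x in I, g x = ∫ x in (-1 : ℝ)..1, g x := by
  rw [intervalIntegral.integral_of_le (by norm_num), integral_Ioc_eq_integral_Ioo]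

theorem intervalIntegrable_of_integrable_I {g : ℝ → ℂ} (hg : Integrable g (volume.restrict I))
    {x y : ℝ} (hx : x ∈ Icc (-1 : ℝ) 1) (hy : y ∈ Icc (-1 : ℝ) 1) :
    IntervalIntegrable g volume x y := by
  have h : IntegrableOn g (Icc (-1) 1) := (integrableOn_Icc_iff_integrableOn_Ioo).2 hg
  rw [intervalIntegrable_iff]
  exact h.mono_set (uIoc_subset_uIcc.trans (uIcc_subset_Icc hx hy))

theorem continuousOn_primitive_I {g : ℝ → ℂ} (hg : Integrable g (volume.restrict I)) :
    ContinuousOn (fun x => ∫ y in (-1 : ℝ)..x, g y) (Icc (-1) 1) :=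
  intervalIntegral.continuousOn_primitive_interval' (μ := volume) (b₁ := -1) (b₂ := 1)
    (intervalIntegrable_of_integrable_I hg (by simp) (by simp)) (by simp) |>.mono (by
      rw [uIcc_of_le (by norm_num)])

theorem integrable_I_of_continuousOn {F : ℝ → ℂ} (hF : ContinuousOn F (Icc (-1) 1)) :
    Integrable F (volume.restrict I) :=
  (hF.integrableOn_Icc).mono_set Ioo_subset_Icc_self

theorem integrable_I_mul {φ : ℝ → ℂ} (hφ : Continuous φ) {g : ℝ → ℂ}
    (hg : Integrable g (volume.restrict I)) :
    Integrable (fun x => φ x * g x) (volume.restrict I) := by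
  have h : IntegrableOn g (Icc (-1) 1) := (integrableOn_Icc_iff_integrableOn_Ioo).2 hg
  exact (h.continuousOn_mul hφ.continuousOn isCompact_Icc).mono_set Ioo_subset_Icc_self

/-- Integration by parts against a primitive of an integrable function. -/
theorem integral_deriv_mul_primitive {g : ℝ → ℂ} (hg : Integrable g (volume.restrict I)) (c : ℂ)
    {φ φ' : ℝ → ℂ} (hφ : ∀ x, HasDerivAt φ (φ' x) x) (hφ' : Continuous φ') :
    ∫ x in I, φ' x * (c + ∫ y in (-1 : ℝ)..x, g y)
      = φ 1 * (c + ∫ y in (-1 : ℝ)..1, g y) - φ (-1) * c - ∫ x in I, φ x * g x := by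
  have hφc : Continuous φ := continuous_iff_continuousAt.2 fun x => (hφ x).continuousAt
  have hφi : Integrable φ' (volume.restrict I) := integrable_I_of_continuousOn hφ'.continuousOn
  have hftc : ∀ a b : ℝ, ∫ x in a..b, φ' x = φ b - φ a := fun a b =>
    intervalIntegral.integral_eq_sub_of_hasDerivAt (fun x _ => hφ x) (hφ'.intervalIntegrable _ _)
  -- Fubini on the triangle y ≤ x; no differentiability of the primitive of g is needed.
  have hswap : ∫ x in I, φ' x * (∫ y in (-1 : ℝ)..x, g y) = ∫ y in I, (φ 1 - φ y) * g y := by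
    set ν := (volume : Measure ℝ).restrict I
    have hprod : Integrable (fun p : ℝ × ℝ => {p : ℝ × ℝ | p.2 ≤ p.1}.indicator
        (fun p => φ' p.1 * g p.2) p) (ν.prod ν) :=
      (hφi.mul_prod hg).indicator (measurableSet_le measurable_snd measurable_fst)
    have h1 : ∫ x, φ' x * (∫ y in (-1 : ℝ)..x, g y) ∂ν
        = ∫ x, ∫ y, {p : ℝ × ℝ | p.2 ≤ p.1}.indicator (fun p => φ' p.1 * g p.2) (x, y) ∂ν ∂ν := by
      refine integral_congr_ae ?_
      filter_upwards [ae_restrict_mem (μ := volume) (measurableSet_Ioo : MeasurableSet I)] with x hx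
      rw [integral_Ioc_eq_setIntegral_Iic hx, ← integral_indicator measurableSet_Iic,
        ← integral_const_mul]
      congr 1 with y
      by_cases h : y ≤ x <;> simp [indicator, h]
    have h2 : ∫ y, (φ 1 - φ y) * g y ∂ν
        = ∫ y, ∫ x, {p : ℝ × ℝ | p.2 ≤ p.1}.indicator (fun p => φ' p.1 * g p.2) (x, y) ∂ν ∂ν := by
      refine integral_congr_ae ?_
      filter_upwards [ae_restrict_mem (μ := volume) (measurableSet_Ioo : MeasurableSet I)] with y hy
      rw [← hftc, intervalIntegral.integral_of_le hy.2.le, integral_Ioc_eq_integral_Ioo,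
        ← integral_Ico_eq_integral_Ioo, ← integral_mul_const,
        show Ico y 1 = Ici y ∩ I by
          ext x
          simp only [mem_Ico, mem_inter_iff, mem_Ici, mem_Ioo]
          exact ⟨fun h => ⟨h.1, hy.1.trans_le h.1, h.2⟩, fun h => ⟨h.1, h.2.2⟩⟩,
        ← Measure.restrict_restrict measurableSet_Ici, ← integral_indicator measurableSet_Ici]
      congr 1 with x
    rw [h1, h2]
    exact integral_integral_swap hprod
  have hP : Integrable (fun x => ∫ y in (-1 : ℝ)..x, g y) (volume.restrict I) :=
    integrable_I_of_continuousOn (continuousOn_primitive_I hg)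
  have e1 : ∫ x in I, φ' x * (c + ∫ y in (-1 : ℝ)..x, g y)
      = (φ 1 - φ (-1)) * c + ∫ x in I, φ' x * ∫ y in (-1 : ℝ)..x, g y := by
    simp only [mul_add]
    rw [integral_add (hφi.mul_const c) (integrable_I_mul hφ' hP), integral_mul_const,
      integral_I_eq_intervalIntegral, hftc]
  have e2 : ∫ y in I, (φ 1 - φ y) * g y
      = φ 1 * (∫ y in (-1 : ℝ)..1, g y) - ∫ y in I, φ y * g y := by
    simp only [sub_mul]
    rw [integral_sub (hg.const_mul _) (integrable_I_mul hφc hg), integral_const_mul,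
      integral_I_eq_intervalIntegral]
  rw [e1, hswap, e2]
  ring

/-- The lemma of du Bois-Reymond on `I`. -/
theorem exists_ae_eq_const_of_integral_deriv {h : ℝ → ℂ} (hh : Integrable h (volume.restrict I))
    (hd : ∀ φ : ℝ → ℝ, ContDiff ℝ ∞ φ → HasCompactSupport φ → tsupport φ ⊆ I →
      ∫ x in I, deriv φ x • h x = 0) :
    ∃ c : ℂ, ∀ᵐ x ∂(volume.restrict I), h x = c := by
  let β : ContDiffBump (0 : ℝ) := ⟨1 / 4, 1 / 2, by norm_num, by norm_num⟩
  set ρ : ℝ → ℝ := β.normed volume with hρ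
  have hρs : ContDiff ℝ ∞ ρ := β.contDiff_normed
  have hρI : tsupport ρ ⊆ I := by
    rw [hρ, β.tsupport_normed_eq, Real.closedBall_eq_Icc]
    intro x hx
    have h1 : -(1 / 2 : ℝ) ≤ x := by simpa [β] using hx.1
    have h2 : x ≤ (1 / 2 : ℝ) := by simpa [β] using hx.2
    exact ⟨by linarith, by linarith⟩
  have hρc : HasCompactSupport ρ := β.hasCompactSupport_normed
  have hρ1 : ∫ x, ρ x = 1 := β.integral_normed
  set c : ℂ := ∫ x in I, ρ x • h x with hc
  refine ⟨c, ?_⟩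
  have hint : Integrable (fun x => h x - c) (volume.restrict I) := hh.sub (integrable_const c)
  have key := isOpen_Ioo.ae_eq_zero_of_integral_contDiff_smul_eq_zero (U := I)
    (f := fun x => h x - c) (μ := volume.restrict I)
    (hint.locallyIntegrable.locallyIntegrableOn I) ?_
  · filter_upwards [key, ae_restrict_mem (μ := volume) (measurableSet_Ioo : MeasurableSet I)]
      with x hx hxI
    exact sub_eq_zero.1 (hx hxI)
  intro ψ hψ hψc hψI
  set m : ℝ := ∫ x, ψ x with hm
  -- Removing the mean with a fixed bump ρ makes the primitive of χ compactly supported in I, so it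
  -- is an admissible test function.
  set χ : ℝ → ℝ := fun x => ψ x - m * ρ x with hχ
  have hχs : ContDiff ℝ ∞ χ := hψ.sub (contDiff_const.mul hρs)
  have hχc : HasCompactSupport χ := hψc.sub (hρc.mul_left)
  have hχI : tsupport χ ⊆ I := by
    refine (tsupport_sub _ _).trans (union_subset hψI ?_)
    exact (tsupport_mul_subset_right).trans hρI
  have hχ0 : ∫ x, χ x = 0 := by
    rw [hχ, integral_sub (hψ.continuous.integrable_of_hasCompactSupport hψc)
      ((hρs.continuous.integrable_of_hasCompactSupport hρc).const_mul m), integral_const_mul, hρ1,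
      mul_one, sub_self]
  obtain ⟨a, b, ha, hb, hab⟩ : ∃ a b : ℝ, -1 < a ∧ b < 1 ∧ ∀ x, χ x ≠ 0 → x ∈ Icc a b := by
    -- The point 0 is added only to have a nonempty set when χ vanishes identically.
    have hK : IsCompact (tsupport χ ∪ {0}) := hχc.isCompact.union isCompact_singleton
    have hne : (tsupport χ ∪ {0}).Nonempty := ⟨0, Or.inr rfl⟩
    have hKI : tsupport χ ∪ {0} ⊆ I := union_subset hχI (by simp)
    obtain ⟨a, ha, ha'⟩ := hK.exists_isLeast hne
    obtain ⟨b, hb, hb'⟩ := hK.exists_isGreatest hne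
    exact ⟨a, b, (hKI ha).1, (hKI hb).2, fun x hx =>
      ⟨ha' (Or.inl (subset_tsupport _ hx)), hb' (Or.inl (subset_tsupport _ hx))⟩⟩
  set Φ : ℝ → ℝ := fun x => ∫ y in (-1 : ℝ)..x, χ y with hΦ
  have hΦd : ∀ x, HasDerivAt Φ (χ x) x := fun x =>
    (hχs.continuous.integral_hasStrictDerivAt _ _).hasDerivAt
  have hΦd' : deriv Φ = χ := funext fun x => (hΦd x).deriv
  have hΦs : ContDiff ℝ ∞ Φ :=
    contDiff_infty_iff_deriv.2 ⟨fun x => (hΦd x).differentiableAt, hΦd'.symm ▸ hχs⟩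
  have hzero : ∀ x, x ∉ Icc a b → χ x = 0 := fun x hx => by_contra fun h => hx (hab x h)
  have hΦ0 : ∀ x, x ∉ Icc a b → Φ x = 0 := by
    intro x hx
    rcases lt_or_ge x a with hxa | hxa
    · rw [hΦ]
      refine (intervalIntegral.integral_congr (g := fun _ => (0 : ℝ)) fun y hy => ?_).trans (by simp)
      refine hzero y fun hy' => ?_
      have : y ≤ max (-1) x := hy.2
      have : max (-1) x < a := max_lt ha hxa
      linarith [hy'.1]
    · have hxb : b < x := by
        by_contra hxb
        exact hx ⟨hxa, not_lt.1 hxb⟩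
      rw [hΦ]
      have hsupp : Function.support χ ⊆ Ioc (-1) x := fun y hy =>
        ⟨ha.trans_le (hab y hy).1, (hab y hy).2.trans hxb.le⟩
      exact (intervalIntegral.integral_eq_integral_of_support_subset hsupp).trans hχ0
  have hΦc : HasCompactSupport Φ := HasCompactSupport.intro isCompact_Icc hΦ0
  have hΦI : tsupport Φ ⊆ I := by
    refine (closure_minimal (fun x hx => ?_) isClosed_Icc).trans
      (fun x (hx : x ∈ Icc a b) => ⟨ha.trans_le hx.1, hx.2.trans_lt hb⟩)
    exact by_contra fun h => hx (hΦ0 x h)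
  have hfin := hd Φ hΦs hΦc hΦI
  rw [hΦd'] at hfin
  have hψh : Integrable (fun x => ψ x • h x) (volume.restrict I) :=
    hh.locallyIntegrable.integrable_smul_left_of_hasCompactSupport hψ.continuous hψc
  have hρh : Integrable (fun x => ρ x • h x) (volume.restrict I) :=
    hh.locallyIntegrable.integrable_smul_left_of_hasCompactSupport hρs.continuous hρc
  have e1 : ∫ x in I, χ x • h x = (∫ x in I, ψ x • h x) - m • c := by
    simp only [hχ, sub_smul, mul_smul]
    have hmρh : Integrable (fun x => m • ρ x • h x) (volume.restrict I) := hρh.smul m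
    rw [integral_sub hψh hmρh, integral_smul]
  have hmI : ∫ x in I, ψ x = m :=
    setIntegral_eq_integral_of_forall_compl_eq_zero fun x hx =>
      image_eq_zero_of_notMem_tsupport fun h => hx (hψI h)
  have hψi : Integrable ψ (volume.restrict I) :=
    (hψ.continuous.integrable_of_hasCompactSupport hψc).restrict
  simp only [smul_sub]
  rw [integral_sub hψh (hψi.smul_const c), integral_smul_const, hmI, ← e1, hfin]

theorem memLp_I_of_continuousOn {q : ℝ≥0∞} {F : ℝ → ℂ}
    (hF : ContinuousOn F (Icc (-1) 1)) :
    MemLp F q (volume.restrict I) := by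
  obtain ⟨C, hC⟩ := isCompact_Icc.exists_bound_of_continuousOn hF
  refine MemLp.of_bound (integrable_I_of_continuousOn hF).1 C ?_
  filter_upwards [ae_restrict_mem (μ := volume) (measurableSet_Ioo : MeasurableSet I)] with x hx
  exact hC x (Ioo_subset_Icc_self hx)

variable {q : ℝ≥0∞} [hq : Fact (1 ≤ q)]

theorem integral_deriv_smul_primitive {g : ℝ → ℂ} (hg : Integrable g (volume.restrict I)) (c : ℂ)
    {φ : ℝ → ℝ} (hφ : ContDiff ℝ ∞ φ) (hI : tsupport φ ⊆ I) :
    ∫ x in I, deriv φ x • (c + ∫ y in (-1 : ℝ)..x, g y) = -∫ x in I, φ x • g x := by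
  have h0 : ∀ x, x ∉ I → φ x = 0 := fun x hx => image_eq_zero_of_notMem_tsupport fun h => hx (hI h)
  have h := integral_deriv_mul_primitive hg c (φ := fun x => (φ x : ℂ))
    (φ' := fun x => ((deriv φ x : ℝ) : ℂ))
    (fun x => ((hφ.differentiable (by simp)) x).hasDerivAt.ofReal_comp)
    (Complex.continuous_ofReal.comp (hφ.continuous_deriv (by simp)))
  rw [h0 1 (by simp), h0 (-1) (by simp)] at h
  simpa only [Complex.real_smul, Complex.ofReal_zero, zero_mul, sub_self, zero_sub] using h

/-- The continuous representative of a weakly differentiable function is a primitive of the weak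
derivative. -/
theorem IsWeakDeriv.contRep_eq {u v : LqI q} (h : IsWeakDeriv u v) {F : ℝ → ℂ}
    (hF : IsContRep u F) : ∀ x ∈ Icc (-1 : ℝ) 1, F x = F (-1) + ∫ y in (-1 : ℝ)..x, v y := by
  have hv := LqI.integrable v
  have hPc := continuousOn_primitive_I hv
  have hP := integrable_I_of_continuousOn hPc
  -- The difference of u and the primitive of v has zero weak derivative, hence is a constant.
  obtain ⟨c, hc⟩ := exists_ae_eq_const_of_integral_deriv
    (h := fun x => u x - ∫ y in (-1 : ℝ)..x, v y) ((LqI.integrable u).sub hP) (fun φ hφ hφc hφI => by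
      have hd := hφ.continuous_deriv (by simp)
      have h2 := integral_deriv_smul_primitive hv 0 hφ hφI
      simp only [zero_add] at h2
      simp only [smul_sub]
      rw [integral_sub (integrable_smul_of_test hd hφc.deriv u)
        (hP.locallyIntegrable.integrable_smul_left_of_hasCompactSupport hd hφc.deriv),
        h φ hφ hφc hφI, h2, sub_self])
  have hae : F =ᵐ[volume.restrict (Icc (-1) 1)] fun x => c + ∫ y in (-1 : ℝ)..x, v y := by
    rw [← restrict_Ioo_eq_restrict_Icc]
    filter_upwards [hc, hF.2] with x h1 h2
    rw [h2, ← h1, sub_add_cancel]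
  have heq := Measure.eqOn_Icc_of_ae_eq volume (by norm_num) hae hF.1 (continuousOn_const.add hPc)
  have hm1 : F (-1) = c := by simpa using heq (left_mem_Icc.2 (by norm_num))
  intro x hx
  rw [hm1]
  exact heq hx

/-- Here φ need not vanish at ±1, so the boundary traces appear; this is how the FK conditions
enter. -/
theorem IsWeakDeriv.integral_deriv_mul {u v : LqI q} (h : IsWeakDeriv u v) {F : ℝ → ℂ}
    (hF : IsContRep u F) {φ φ' : ℝ → ℂ} (hφ : ∀ x, HasDerivAt φ (φ' x) x) (hφ' : Continuous φ') :
    ∫ x in I, φ' x * u x = φ 1 * F 1 - φ (-1) * F (-1) - ∫ x in I, φ x * v x := by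
  have hrep := h.contRep_eq hF
  rw [hrep 1 (by simp), ← integral_deriv_mul_primitive (LqI.integrable v) _ hφ hφ']
  refine integral_congr_ae ?_
  filter_upwards [hF.2, ae_restrict_mem (μ := volume) (measurableSet_Ioo : MeasurableSet I)]
    with x hx hxI
  rw [← hx, hrep x (Ioo_subset_Icc_self hxI)]

/-- Variation of constants for `u' = μ u - f`. -/
theorem exists_weakDeriv_sub (f : LqI q) (μ c : ℂ) :
    ∃ u : LqI q, IsContRep u (fun x => Complex.exp (μ * x) *
        (c - ∫ y in (-1 : ℝ)..x, Complex.exp (-μ * y) * f y)) ∧ IsWeakDeriv u (μ • u - f) := by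
  have hec : ∀ ν : ℂ, Continuous fun x : ℝ => Complex.exp (ν * x) := fun ν => by fun_prop
  set g : ℝ → ℂ := fun y => Complex.exp (-μ * y) * f y with hg
  have hgi : Integrable g (volume.restrict I) := integrable_I_mul (hec _) (LqI.integrable f)
  set H : ℝ → ℂ := fun x => c - ∫ y in (-1 : ℝ)..x, g y with hH
  set F : ℝ → ℂ := fun x => Complex.exp (μ * x) * H x with hF
  have hHc : ContinuousOn H (Icc (-1) 1) := continuousOn_const.sub (continuousOn_primitive_I hgi)
  have hFc : ContinuousOn F (Icc (-1) 1) := (hec μ).continuousOn.mul hHc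
  have hFm : MemLp F q (volume.restrict I) := memLp_I_of_continuousOn hFc
  set u : LqI q := hFm.toLp F with hu
  have hrep : ∀ᵐ x ∂(volume.restrict I), F x = u x := hFm.coeFn_toLp.symm
  refine ⟨u, ⟨hFc, hrep⟩, fun φ hφ hφc hφI => ?_⟩
  have hd := hφ.continuous_deriv (by simp)
  have h0 : ∀ x, x ∉ I → φ x = 0 := fun x hx =>
    image_eq_zero_of_notMem_tsupport fun h => hx (hφI h)
  -- Testing with φe^{μx} transfers the exponential factor of u to the test function.
  have hparts := integral_deriv_mul_primitive hgi.neg c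
    (φ := fun x => (φ x : ℂ) * Complex.exp (μ * x))
    (φ' := fun x => ((deriv φ x : ℝ) : ℂ) * Complex.exp (μ * x) + φ x * (Complex.exp (μ * x) * μ))
    (fun x => by
      refine ((hφ.differentiable (by simp)) x).hasDerivAt.ofReal_comp.mul ?_
      have := ((Complex.ofRealCLM.hasDerivAt (x := x)).const_mul μ).cexp
      simpa using this)
    (((Complex.continuous_ofReal.comp hd).mul (hec μ)).add
      ((Complex.continuous_ofReal.comp hφ.continuous).mul ((hec μ).mul continuous_const)))
  simp only [h0 1 (by simp), h0 (-1) (by simp), Pi.neg_apply, intervalIntegral.integral_neg,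
    Complex.ofReal_zero, zero_mul, sub_zero, zero_sub, ← sub_eq_add_neg] at hparts
  have hui := LqI.integrable u
  have e1 : ∫ x in I, (((deriv φ x : ℝ) : ℂ) * Complex.exp (μ * x) + φ x * (Complex.exp (μ * x) * μ)) *
      (c - ∫ y in (-1 : ℝ)..x, g y)
      = (∫ x in I, deriv φ x • u x) + μ * ∫ x in I, φ x • u x := by
    rw [← integral_const_mul, ← integral_add (integrable_smul_of_test hd hφc.deriv u)
      ((integrable_smul_of_test hφ.continuous hφc u).const_mul μ)]
    refine integral_congr_ae ?_
    filter_upwards [hrep] with x hx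
    rw [← hx, hF, hH, Complex.real_smul, Complex.real_smul]
    ring
  have e2 : ∫ x in I, (φ x : ℂ) * Complex.exp (μ * x) * -g x = -∫ x in I, φ x • f x := by
    rw [← integral_neg]
    refine integral_congr_ae (Eventually.of_forall fun x => ?_)
    simp only [hg, Complex.real_smul]
    have : Complex.exp (μ * x) * Complex.exp (-μ * x) = 1 := by
      rw [← Complex.exp_add]
      simp
    linear_combination (-(φ x : ℂ) * f x) * this
  have e3 : ∫ x in I, φ x • (μ • u - f : LqI q) x
      = μ * (∫ x in I, φ x • u x) - ∫ x in I, φ x • f x := by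
    rw [← integral_const_mul, ← integral_sub
      ((integrable_smul_of_test hφ.continuous hφc u).const_mul μ)
      (integrable_smul_of_test hφ.continuous hφc f)]
    refine integral_congr_ae ?_
    filter_upwards [Lp.coeFn_sub (μ • u) f, Lp.coeFn_smul μ u] with x h1 h2
    rw [h1, Pi.sub_apply, h2, Pi.smul_apply, smul_eq_mul, Complex.real_smul, Complex.real_smul,
      Complex.real_smul]
    ring
  rw [e1, e2] at hparts
  rw [e3]
  linear_combination hparts

end Calculus

/-! ### Adjoint eigenfunctions, and surjectivity of 1 - A_q. -/

section Eigen

variable {q : ℝ≥0∞} [hq : Fact (1 ≤ q)]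

/-- Hölder's inequality on a set of finite measure. -/
theorem exists_integral_norm_le (q : ℝ≥0∞) [hq : Fact (1 ≤ q)] :
    ∃ C : ℝ, 0 ≤ C ∧ ∀ f : LqI q, ∫ x in I, ‖f x‖ ≤ C * ‖f‖ := by
  refine ⟨(((volume.restrict I) univ) ^ (1 / (1 : ℝ≥0∞).toReal - 1 / q.toReal)).toReal,
    ENNReal.toReal_nonneg, fun f => ?_⟩
  have h := eLpNorm_le_eLpNorm_mul_rpow_measure_univ hq.out (Lp.memLp f).1
  rw [integral_norm_eq_lintegral_enorm (Lp.memLp f).1, ← eLpNorm_one_eq_lintegral_enorm, Lp.norm_def,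
    mul_comm, ← ENNReal.toReal_mul]
  have hexp : 0 ≤ 1 / (1 : ℝ≥0∞).toReal - 1 / q.toReal := by
    rcases eq_or_ne q ⊤ with rfl | hqt
    · simp
    · have h1 : 1 ≤ q.toReal := by
        simpa using (ENNReal.toReal_le_toReal ENNReal.one_ne_top hqt).2 hq.out
      simpa using inv_le_one_of_one_le₀ h1
  exact ENNReal.toReal_mono (ENNReal.mul_ne_top (Lp.eLpNorm_ne_top f)
    (ENNReal.rpow_ne_top_of_nonneg hexp (by simp))) h

/-- The functional `f ↦ ∫_I φ f` for continuous `φ`. -/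
def pairing (q : ℝ≥0∞) [Fact (1 ≤ q)] (φ : C(ℝ, ℂ)) : LqI q →L[ℂ] ℂ :=
  LinearMap.mkContinuousOfExistsBound
    { toFun := fun f => ∫ x in I, φ x * f x
      map_add' := fun f g => by
        rw [← integral_add (integrable_I_mul φ.continuous (LqI.integrable f))
          (integrable_I_mul φ.continuous (LqI.integrable g))]
        refine integral_congr_ae ?_
        filter_upwards [Lp.coeFn_add f g] with x hx
        rw [hx, Pi.add_apply, mul_add]
      map_smul' := fun c f => by
        rw [RingHom.id_apply, smul_eq_mul, ← integral_const_mul]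
        refine integral_congr_ae ?_
        filter_upwards [Lp.coeFn_smul c f] with x hx
        rw [hx, Pi.smul_apply, smul_eq_mul]
        ring } (by
    obtain ⟨C, hC0, hC⟩ := exists_integral_norm_le q
    obtain ⟨K, hK⟩ := isCompact_Icc.exists_bound_of_continuousOn
      (φ.continuous.continuousOn (s := Icc (-1 : ℝ) 1))
    refine ⟨K * C, fun f => ?_⟩
    have hK0 : 0 ≤ K := (norm_nonneg _).trans (hK 0 (by simp))
    rw [mul_assoc]
    refine le_trans ?_ (mul_le_mul_of_nonneg_left (hC f) hK0)
    rw [← integral_const_mul]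
    refine norm_integral_le_of_norm_le ((LqI.integrable f).norm.const_mul K) ?_
    filter_upwards [ae_restrict_mem (μ := volume) (measurableSet_Ioo : MeasurableSet I)] with x hx
    rw [norm_mul]
    exact mul_le_mul_of_nonneg_right (hK x (Ioo_subset_Icc_self hx)) (norm_nonneg _))

theorem pairing_apply (φ : C(ℝ, ℂ)) (f : LqI q) : pairing q φ f = ∫ x in I, φ x * f x := rfl

/-- The adjoint eigenfunction `e^{-iκx} + i e^{iκx}`. -/
def eigenfun (κ : ℝ) : C(ℝ, ℂ) where
  toFun x := Complex.exp (-Complex.I * κ * x) + Complex.I * Complex.exp (Complex.I * κ * x)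
  continuous_toFun := by fun_prop

theorem eigenfun_apply (κ x : ℝ) : eigenfun κ x
    = Complex.exp (-Complex.I * κ * x) + Complex.I * Complex.exp (Complex.I * κ * x) := rfl

theorem hasDerivAt_exp_mul_ofReal (ν : ℂ) (x : ℝ) :
    HasDerivAt (fun x : ℝ => Complex.exp (ν * x)) (ν * Complex.exp (ν * x)) x := by
  have := ((Complex.ofRealCLM.hasDerivAt (x := x)).const_mul ν).cexp
  simpa [mul_comm] using this

/-- Two integrations by parts against an adjoint eigenfunction. -/
theorem IsFK.pairing_eigenfun {θ κ : ℝ}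
    (hκ : Complex.exp (-2 * Complex.I * κ) * (1 + Complex.I * (1 - θ)) = (1 - θ) + Complex.I)
    {u v w : LqI q} (h : IsFK θ u v w) :
    pairing q (eigenfun κ) w = -(κ : ℂ) ^ 2 * pairing q (eigenfun κ) u := by
  obtain ⟨huv, hvw, F, G, hF, hG, b1, b2⟩ := h
  set ψ' : ℝ → ℂ := fun x => -Complex.I * κ * Complex.exp (-Complex.I * κ * x)
    + Complex.I * (Complex.I * κ * Complex.exp (Complex.I * κ * x)) with hψ'
  have hψ'c : Continuous ψ' := by fun_prop
  have hd1 : ∀ x, HasDerivAt (eigenfun κ) (ψ' x) x := fun x =>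
    (hasDerivAt_exp_mul_ofReal _ x).add ((hasDerivAt_exp_mul_ofReal _ x).const_mul _)
  have hd2 : ∀ x, HasDerivAt ψ' (-(κ : ℂ) ^ 2 * eigenfun κ x) x := fun x => by
    have := ((hasDerivAt_exp_mul_ofReal (-Complex.I * κ) x).const_mul (-Complex.I * κ)).add
      (((hasDerivAt_exp_mul_ofReal (Complex.I * κ) x).const_mul (Complex.I * κ)).const_mul Complex.I)
    convert! this using 1
    rw [eigenfun_apply]
    linear_combination (-(κ : ℂ) ^ 2 * Complex.exp (-Complex.I * κ * x)
      - κ ^ 2 * Complex.I * Complex.exp (Complex.I * κ * x)) * Complex.I_sq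
  have i1 := hvw.integral_deriv_mul hG hd1 hψ'c
  have i2 := huv.integral_deriv_mul hF hd2 (continuous_const.mul (eigenfun κ).continuous)
  simp only [mul_assoc (-(κ : ℂ) ^ 2)] at i2
  rw [integral_const_mul] at i2
  rw [pairing_apply, pairing_apply]
  set ε := Complex.exp (-Complex.I * κ) with hε
  set η := Complex.exp (Complex.I * κ) with hη
  have hεη : ε * η = 1 := by
    rw [hε, hη, ← Complex.exp_add]
    simp
  have hε2 : Complex.exp (-2 * Complex.I * κ) = ε * ε := by
    rw [hε, ← Complex.exp_add]
    ring_nf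
  rw [hε2] at hκ
  have e1 : Complex.exp (-Complex.I * κ * ((1 : ℝ) : ℂ)) = ε := by simp [hε]
  have e2 : Complex.exp (-Complex.I * κ * ((-1 : ℝ) : ℂ)) = η := by simp [hη]
  have e3 : Complex.exp (Complex.I * κ * ((1 : ℝ) : ℂ)) = η := by simp [hη]
  have e4 : Complex.exp (Complex.I * κ * ((-1 : ℝ) : ℂ)) = ε := by simp [hε]
  simp only [eigenfun_apply, hψ', e1, e2, e3, e4, B₁, B₂] at i1 i2 b1 b2 ⊢
  set a : ℂ := 1 - (θ : ℂ)
  -- The adjoint boundary conditions for ψ = `eigenfun κ`: `k1` amounts, up to the factor -iκ, to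
  -- ψ'(1) = aψ'(-1), and `k2` is aψ(1) = ψ(-1). Together with B₁ and B₂ they cancel all boundary
  -- terms.
  have k1 : ε * (1 + Complex.I * a) = η * (a + Complex.I) := by
    linear_combination η * hκ - ε * (1 + Complex.I * a) * hεη
  have k2 : a * (ε + Complex.I * η) = η + Complex.I * ε := by
    linear_combination (-Complex.I) * k1 + (a * ε - η) * Complex.I_sq
  linear_combination i1 - i2 + (ε + Complex.I * η) * b2 + G (-1) * k2
    - (-Complex.I * κ * η + Complex.I * (Complex.I * κ * ε)) * b1 + F 1 * (Complex.I * κ) * k1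

/-- The determinant is P² + Q². The two FK conditions on the free constants α, β below form a system
of exactly this shape. -/
theorem exists_rotation_solve {P Q : ℂ} (h : P ^ 2 + Q ^ 2 ≠ 0) (s t : ℂ) :
    ∃ α β : ℂ, P * α - Q * β = s ∧ Q * α + P * β = t := by
  refine ⟨(P * s + Q * t) / (P ^ 2 + Q ^ 2), (P * t - Q * s) / (P ^ 2 + Q ^ 2), ?_, ?_⟩ <;>
  · field_simp
    ring

/-- `u - u'' = f` is solvable under the FK boundary conditions. -/
theorem exists_isFK_sub_eq {θ : ℝ} (hθ0 : 0 ≤ θ) (f : LqI q) :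
    ∃ u v : LqI q, IsFK θ u v (u - f) := by
  set h : LqI q := (2⁻¹ : ℂ) • f with hh
  set A : ℂ := ∫ y in (-1 : ℝ)..1, Complex.exp (-1 * y) * h y with hA
  set B : ℂ := ∫ y in (-1 : ℝ)..1, Complex.exp (- -1 * y) * (-h : LqI q) y with hB
  set e : ℂ := Complex.exp 1 with he
  set d : ℂ := Complex.exp (-1) with hd
  set a : ℂ := 1 - (θ : ℂ) with ha
  have hdet : (a * e - d) ^ 2 + (e - a * d) ^ 2 ≠ 0 := by
    have h1 : Real.exp (-1) < Real.exp 1 := Real.exp_lt_exp.2 (by norm_num)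
    -- This real entry is positive because 1 - θ ≤ 1, which keeps the sum of squares nonzero.
    have h2 : 0 < Real.exp 1 - (1 - θ) * Real.exp (-1) := by
      nlinarith [Real.exp_pos (-1), mul_nonneg hθ0 (Real.exp_pos (-1)).le]
    have h3 : 0 < ((1 - θ) * Real.exp 1 - Real.exp (-1)) ^ 2
        + (Real.exp 1 - (1 - θ) * Real.exp (-1)) ^ 2 := by positivity
    have h4 : (((((1 - θ) * Real.exp 1 - Real.exp (-1)) ^ 2
        + (Real.exp 1 - (1 - θ) * Real.exp (-1)) ^ 2 : ℝ)) : ℂ) ≠ 0 := by exact_mod_cast h3.ne'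
    simpa [ha, he, hd] using h4
  set s : ℂ := a * (e * A + d * B)
  set t : ℂ := e * A - d * B
  obtain ⟨α, β, hs, ht⟩ := exists_rotation_solve hdet s t
  -- Splitting into first-order equations p' = p - f/2 and r' = -r + f/2: then u = p + r has u' = p
  -- - r and u'' = u - f.
  obtain ⟨p, hp, hpd⟩ := exists_weakDeriv_sub h 1 α
  obtain ⟨r, hr, hrd⟩ := exists_weakDeriv_sub (-h) (-1) β
  have hff : f = h + h := by
    rw [hh, ← add_smul]
    norm_num
  have w1 := hpd.add hrd
  have w2 := hpd.add (hrd.smul (-1))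
  have ev : (1 : ℂ) • p - h + ((-1 : ℂ) • r - -h) = p + (-1 : ℂ) • r := by
    rw [one_smul]
    abel
  have ew : (1 : ℂ) • p - h + (-1 : ℂ) • ((-1 : ℂ) • r - -h) = p + r - f := by
    rw [hff, one_smul]
    simp only [neg_smul, one_smul]
    abel
  rw [ev] at w1
  rw [ew] at w2
  have e1 : Complex.exp (1 * ((1 : ℝ) : ℂ)) = e := by simp [he]
  have e2 : Complex.exp (1 * ((-1 : ℝ) : ℂ)) = d := by simp [hd]
  have e3 : Complex.exp (-1 * ((1 : ℝ) : ℂ)) = d := by simp [hd]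
  have e4 : Complex.exp (-1 * ((-1 : ℝ) : ℂ)) = e := by simp [he]
  refine ⟨p + r, p + (-1 : ℂ) • r, w1, w2, _, _, hp.add hr, hp.add (hr.smul (-1)), ?_, ?_⟩
  · simp only [B₁, Pi.add_apply, intervalIntegral.integral_same, sub_zero, e1, e2, e3, e4,
      ← hA, ← hB, ← ha]
    linear_combination hs
  · simp only [B₂, Pi.add_apply, Pi.smul_apply, smul_eq_mul, intervalIntegral.integral_same, sub_zero, e1, e2,
      e3, e4, ← hA, ← hB, ← ha]
    linear_combination ht

end Eigen

/-! ### The quasi-periodic translation group and its conjugate by reflection. -/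

section Group

instance fact_two_pos : Fact ((0 : ℝ) < 2) := ⟨two_pos⟩

/-- The translation `x ↦ x + s`, from the line to the circle of length `2`. -/
def shift (s : ℝ) : C(ℝ, AddCircle (2 : ℝ)) where
  toFun x := ((x + s : ℝ) : AddCircle (2 : ℝ))
  continuous_toFun := (AddCircle.continuous_mk' 2).comp (continuous_id.add continuous_const)

theorem continuous_shift : Continuous shift :=
  ContinuousMap.continuous_of_continuous_uncurry _
    ((AddCircle.continuous_mk' 2).comp (continuous_snd.add continuous_fst))

theorem restrict_Ioc_eq_restrict_I :
    (volume : Measure ℝ).restrict (Ioc (-1) (-1 + 2)) = volume.restrict I := by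
  rw [show (-1 + 2 : ℝ) = 1 by norm_num, restrict_Ioo_eq_restrict_Ioc]

theorem measurePreserving_shift (s : ℝ) :
    MeasurePreserving (shift s) (volume.restrict I) volume := by
  have h1 := AddCircle.measurePreserving_mk 2 (-1)
  rw [restrict_Ioc_eq_restrict_I] at h1
  have h2 := (measurePreserving_add_right (volume : Measure (AddCircle (2 : ℝ)))
    (s : AddCircle (2 : ℝ))).comp h1
  exact h2

/-- The representative of a point of the circle in `(-1, 1]`. -/
def lift (y : AddCircle (2 : ℝ)) : ℝ := (AddCircle.measurableEquivIoc 2 (-1) y : ℝ)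

theorem coe_lift (y : AddCircle (2 : ℝ)) : ((lift y : ℝ) : AddCircle (2 : ℝ)) = y :=
  (AddCircle.measurableEquivIoc 2 (-1)).symm_apply_apply y

theorem measurePreserving_lift : MeasurePreserving lift volume (volume.restrict I) := by
  rw [← restrict_Ioc_eq_restrict_I]
  exact (measurePreserving_subtype_coe measurableSet_Ioc).comp
    (AddCircle.measurePreserving_equivIoc 2)

theorem measurePreserving_neg_I :
    MeasurePreserving (Neg.neg : ℝ → ℝ) (volume.restrict I) (volume.restrict I) := by
  have h := (Measure.measurePreserving_neg (volume : Measure ℝ)).restrict_preimage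
    (measurableSet_Ioo : MeasurableSet I)
  rwa [show Neg.neg ⁻¹' I = I by
    ext x
    simp only [mem_preimage, mem_Ioo]
    constructor <;> rintro ⟨h1, h2⟩ <;> constructor <;> linarith] at h

theorem integral_comp_of_measurePreserving {α β : Type*} [MeasurableSpace α] [MeasurableSpace β]
    {μ : Measure α} {ν : Measure β} {T : α → β} (hT : MeasurePreserving T μ ν) {g : β → ℂ}
    (hg : AEStronglyMeasurable g ν) : ∫ x, g (T x) ∂μ = ∫ y, g y ∂ν := by
  rw [← hT.map_eq, integral_map hT.measurable.aemeasurable (hT.map_eq.symm ▸ hg)]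

theorem memLp_exp_mul {q : ℝ≥0∞} (c : ℝ) (f : LqI q) :
    MemLp (fun x : ℝ => Complex.exp (Complex.I * c * x) * f x) q (volume.restrict I) := by
  refine (Lp.memLp f).of_le ((by fun_prop : Continuous fun x : ℝ =>
    Complex.exp (Complex.I * c * x)).aestronglyMeasurable.mul (Lp.memLp f).1)
    (Eventually.of_forall fun x => ?_)
  rw [norm_mul, mul_assoc, ← Complex.ofReal_mul, mul_comm Complex.I, Complex.norm_exp_ofReal_mul_I,
    one_mul]

variable {q : ℝ≥0∞} [hq : Fact (1 ≤ q)]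

/-- Multiplication by `e^{icx}` on `L^q(I)`. -/
def modulation (c : ℝ) : LqI q →ₗᵢ[ℂ] LqI q where
  toFun f := (memLp_exp_mul c f).toLp
  map_add' f g := by
    refine Lp.ext ?_
    filter_upwards [(memLp_exp_mul c f).coeFn_toLp, (memLp_exp_mul c g).coeFn_toLp,
      (memLp_exp_mul c (f + g)).coeFn_toLp, Lp.coeFn_add f g,
      Lp.coeFn_add (memLp_exp_mul c f).toLp (memLp_exp_mul c g).toLp] with x h1 h2 h3 h4 h5
    rw [h3, h5, Pi.add_apply, h1, h2, h4, Pi.add_apply, mul_add]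
  map_smul' a f := by
    refine Lp.ext ?_
    filter_upwards [(memLp_exp_mul c f).coeFn_toLp, (memLp_exp_mul c (a • f)).coeFn_toLp,
      Lp.coeFn_smul a f, Lp.coeFn_smul a (memLp_exp_mul c f).toLp] with x h1 h2 h3 h4
    rw [h2, RingHom.id_apply, h4, Pi.smul_apply, h1, h3, Pi.smul_apply, smul_eq_mul, smul_eq_mul]
    ring
  norm_map' f := by
    change ‖(memLp_exp_mul c f).toLp‖ = ‖f‖
    rw [Lp.norm_toLp, Lp.norm_def]
    congr 1
    refine eLpNorm_congr_norm_ae (Eventually.of_forall fun x => ?_)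
    rw [norm_mul, mul_assoc, ← Complex.ofReal_mul, mul_comm Complex.I,
      Complex.norm_exp_ofReal_mul_I, one_mul]

theorem coeFn_modulation (c : ℝ) (f : LqI q) :
    modulation c f =ᵐ[volume.restrict I] fun x : ℝ => Complex.exp (Complex.I * c * x) * f x :=
  (memLp_exp_mul c f).coeFn_toLp

/-- Transport of a function on `I` to the circle. -/
def toCircle : LqI q →ₗᵢ[ℂ] Lp ℂ q (volume : Measure (AddCircle (2 : ℝ))) :=
  Lp.compMeasurePreservingₗᵢ ℂ lift measurePreserving_lift

/-- Restriction to `I` of a translate of a function on the circle. -/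
def translate (s : ℝ) : Lp ℂ q (volume : Measure (AddCircle (2 : ℝ))) →ₗᵢ[ℂ] LqI q :=
  Lp.compMeasurePreservingₗᵢ ℂ (shift s) (measurePreserving_shift s)

/-- Strong continuity of translations in L^q; this is where q < ∞ is needed. -/
theorem continuous_translate (hq2 : q ≠ ⊤) (p : Lp ℂ q (volume : Measure (AddCircle (2 : ℝ)))) :
    Continuous fun s => translate s p :=
  Continuous.compMeasurePreservingLp (f := fun _ : ℝ => p) (g := shift) continuous_const
    continuous_shift measurePreserving_shift hq2

/-- Reflection `f ↦ f(-x)`. -/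
def reflection : LqI q →ₗᵢ[ℂ] LqI q :=
  Lp.compMeasurePreservingₗᵢ ℂ Neg.neg measurePreserving_neg_I

theorem coeFn_reflection (f : LqI q) :
    reflection f =ᵐ[volume.restrict I] fun x : ℝ => f (-x) :=
  Lp.coeFn_compMeasurePreserving f measurePreserving_neg_I

theorem reflection_reflection (f : LqI q) : reflection (reflection f) = f := by
  refine Lp.ext ?_
  filter_upwards [coeFn_reflection (reflection f),
    measurePreserving_neg_I.quasiMeasurePreserving.ae (coeFn_reflection f)] with x h1 h2
  rw [h1, h2, neg_neg]

/-- The group of twisted translations, with generator `∂ₓ` under quasi-periodic boundary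
conditions. -/
def twistedTranslation (c s : ℝ) : LqI q →L[ℂ] LqI q :=
  -- The scalar makes the total phase e^{-ic(x+s)}e^{icy}, with y the representative of x + s in
  -- (-1, 1]: it is 1 until x + s leaves the interval, then jumps by e^{∓2ic} at each crossing.
  Complex.exp (-Complex.I * c * s) • ((modulation (-c)).comp
    ((translate s).comp (toCircle.comp (modulation c)))).toContinuousLinearMap

theorem norm_twistedTranslation_le (c s : ℝ) (f : LqI q) : ‖twistedTranslation c s f‖ ≤ ‖f‖ := by
  rw [twistedTranslation, smul_apply, norm_smul, LinearIsometry.coe_toContinuousLinearMap,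
    LinearIsometry.norm_map,
    show -Complex.I * c * s = ((-(c * s) : ℝ) : ℂ) * Complex.I by push_cast; ring,
    Complex.norm_exp_ofReal_mul_I, one_mul]

theorem continuous_twistedTranslation (hq2 : q ≠ ⊤) (c : ℝ) (f : LqI q) :
    Continuous fun s => twistedTranslation c s f :=
  Continuous.smul (by fun_prop : Continuous fun s : ℝ => Complex.exp (-Complex.I * c * s))
    ((modulation (-c)).continuous.comp (continuous_translate hq2 (toCircle (modulation c f))))

/-- The exponential `e^{-iκx}`. -/
def expfun (κ : ℝ) : C(ℝ, ℂ) where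
  toFun x := Complex.exp (-Complex.I * κ * x)
  continuous_toFun := by fun_prop

theorem fourier_neg_coe (n : ℤ) (x : ℝ) :
    fourier (-n) (x : AddCircle (2 : ℝ)) = Complex.exp (-Complex.I * (Real.pi * n : ℝ) * x) := by
  rw [fourier_coe_apply]
  congr 1
  push_cast
  ring

theorem integral_fourier_mul_toCircle (n : ℤ) (h : LqI q) :
    ∫ y : AddCircle (2 : ℝ), fourier (-n) y * toCircle h y
      = ∫ x in I, Complex.exp (-Complex.I * (Real.pi * n : ℝ) * x) * h x := by
  have hm := measurePreserving_lift
  rw [← integral_comp_of_measurePreserving hm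
    (integrable_I_mul (by fun_prop) (LqI.integrable h)).1]
  refine integral_congr_ae ?_
  filter_upwards [Lp.coeFn_compMeasurePreserving h hm] with y hy
  rw [← fourier_neg_coe, coe_lift]
  congr 1

theorem integral_exp_mul_translate (n : ℤ) (s : ℝ)
    (p : Lp ℂ q (volume : Measure (AddCircle (2 : ℝ)))) :
    ∫ x in I, Complex.exp (-Complex.I * (Real.pi * n : ℝ) * x) * translate s p x
      = Complex.exp (Complex.I * (Real.pi * n : ℝ) * s) * ∫ y, fourier (-n) y * p y := by
  have hm := measurePreserving_shift s
  rw [← integral_comp_of_measurePreserving hm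
    (g := fun y => fourier (-n) y * p y)
    ((fourier (-n)).continuous.aestronglyMeasurable.mul (Lp.memLp p).1), ← integral_const_mul]
  refine integral_congr_ae ?_
  filter_upwards [Lp.coeFn_compMeasurePreserving p hm] with x hx
  have hx' : translate s p x = p (shift s x) := hx
  rw [hx', ← mul_assoc]
  congr 1
  change _ = _ * fourier (-n) ((x + s : ℝ) : AddCircle (2 : ℝ))
  rw [fourier_neg_coe, ← Complex.exp_add]
  congr 1
  push_cast
  ring

/-- Modulation shifts the frequency πn - c to πn, where translation on the circle acts by e^{iπns};
the prefactor e^{-ics} restores πn - c. -/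
theorem pairing_twistedTranslation (c : ℝ) (n : ℤ) (s : ℝ) (f : LqI q) :
    pairing q (expfun (Real.pi * n - c)) (twistedTranslation c s f)
      = Complex.exp (Complex.I * (Real.pi * n - c : ℝ) * s)
        * pairing q (expfun (Real.pi * n - c)) f := by
  have key : ∀ (d : ℝ) (g : LqI q), pairing q (expfun (Real.pi * n - d)) (modulation (-d) g)
      = ∫ x in I, Complex.exp (-Complex.I * (Real.pi * n : ℝ) * x) * g x := fun d g => by
    rw [pairing_apply]
    refine integral_congr_ae ?_
    filter_upwards [coeFn_modulation (-d) g] with x hx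
    rw [hx, ← mul_assoc]
    congr 1
    change Complex.exp _ * _ = _
    rw [← Complex.exp_add]
    congr 1
    push_cast
    ring
  have key2 : ∫ x in I, Complex.exp (-Complex.I * (Real.pi * n : ℝ) * x) * modulation c f x
      = pairing q (expfun (Real.pi * n - c)) f := by
    rw [pairing_apply]
    refine integral_congr_ae ?_
    filter_upwards [coeFn_modulation c f] with x hx
    rw [hx, ← mul_assoc]
    congr 1
    change _ = Complex.exp _
    rw [← Complex.exp_add]
    congr 1
    push_cast
    ring
  have e : twistedTranslation c s f = Complex.exp (-Complex.I * c * s) •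
      modulation (-c) (translate s (toCircle (modulation c f))) := rfl
  rw [e, map_smul, key, integral_exp_mul_translate, integral_fourier_mul_toCircle, key2, smul_eq_mul,
    ← mul_assoc, ← Complex.exp_add]
  congr 2
  push_cast
  ring

/-- Completeness of the exponentials `e^{-iπnx}` in `L¹(I)`. -/
theorem ae_eq_zero_of_fourier {g : ℝ → ℂ} (hg : Integrable g (volume.restrict I))
    (h : ∀ n : ℤ, ∫ x in I, Complex.exp (-Complex.I * (Real.pi * n : ℝ) * x) * g x = 0) :
    ∀ᵐ x ∂(volume.restrict I), g x = 0 := by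
  have hbd : ∀ p : C(AddCircle (2 : ℝ), ℂ),
      Integrable (fun x : ℝ => p (x : AddCircle (2 : ℝ)) * g x) (volume.restrict I) := fun p =>
    integrable_I_mul (p.continuous.comp (AddCircle.continuous_mk' 2)) hg
  let Λ : C(AddCircle (2 : ℝ), ℂ) →L[ℂ] ℂ := LinearMap.mkContinuous
    { toFun := fun p => ∫ x in I, p (x : AddCircle (2 : ℝ)) * g x
      map_add' := fun p r => by
        rw [← integral_add (hbd p) (hbd r)]
        simp only [ContinuousMap.add_apply, add_mul]
      map_smul' := fun a p => by
        rw [RingHom.id_apply, smul_eq_mul, ← integral_const_mul]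
        simp only [ContinuousMap.smul_apply, smul_eq_mul, mul_assoc] }
    (∫ x in I, ‖g x‖) (fun p => by
      rw [mul_comm, ← integral_const_mul]
      refine norm_integral_le_of_norm_le (hg.norm.const_mul _) (Eventually.of_forall fun x => ?_)
      rw [norm_mul]
      exact mul_le_mul_of_nonneg_right (p.norm_coe_le_norm _) (norm_nonneg _))
  have hΛ : ∀ p, Λ p = ∫ x in I, p (x : AddCircle (2 : ℝ)) * g x := fun p => rfl
  have hzero : ∀ p, Λ p = 0 := by
    -- Trigonometric polynomials are uniformly dense, so the continuous functional Λ vanishes on all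
    -- continuous periodic functions.
    have hker : (Submodule.span ℂ (range <| @fourier 2)).topologicalClosure ≤ Λ.ker := by
      refine Submodule.topologicalClosure_minimal _ (Submodule.span_le.2 ?_) Λ.isClosed_ker
      rintro _ ⟨n, rfl⟩
      change Λ (fourier n) = 0
      rw [hΛ, ← h (-n)]
      congr 1 with x
      rw [← fourier_neg_coe, neg_neg]
    rw [span_fourier_closure_eq_top] at hker
    exact fun p => hker (Submodule.mem_top (x := p))
  have key := isOpen_Ioo.ae_eq_zero_of_integral_contDiff_smul_eq_zero (U := I)
    (f := g) (μ := volume.restrict I) (hg.locallyIntegrable.locallyIntegrableOn I)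
    (fun ψ hψ hc hI => by
      have h0 : ∀ x, x ∉ I → ψ x = 0 := fun x hx =>
        image_eq_zero_of_notMem_tsupport fun h => hx (hI h)
      -- A test function supported in I vanishes at ±1, so it extends continuously to the circle.
      let p : C(AddCircle (2 : ℝ), ℂ) := ⟨AddCircle.liftIoc 2 (-1) fun x => (ψ x : ℂ),
        AddCircle.liftIoc_continuous
          (by rw [h0 (-1) (by simp), h0 (-1 + 2) (by norm_num)])
          (Complex.continuous_ofReal.comp hψ.continuous).continuousOn⟩
      rw [← hzero p, hΛ]
      refine setIntegral_congr_fun measurableSet_Ioo fun x hx => ?_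
      have hpx : p (x : AddCircle (2 : ℝ)) = ψ x :=
        AddCircle.liftIoc_coe_apply (p := 2) (a := -1) (f := fun x => (ψ x : ℂ)) ⟨hx.1, by linarith [hx.2]⟩
      simp only [hpx, Complex.real_smul])
  filter_upwards [key, ae_restrict_mem (μ := volume) (measurableSet_Ioo : MeasurableSet I)]
    with x hx hxI using hx hxI

theorem eq_zero_of_pairing_expfun (c : ℝ) (f : LqI q)
    (h : ∀ n : ℤ, pairing q (expfun (Real.pi * n - c)) f = 0) : f = 0 := by
  have hg : Integrable (fun x : ℝ => Complex.exp (Complex.I * c * x) * f x) (volume.restrict I) :=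
    integrable_I_mul (by fun_prop) (LqI.integrable f)
  have := ae_eq_zero_of_fourier hg fun n => by
    rw [← h n, pairing_apply]
    congr 1 with x
    rw [← mul_assoc]
    congr 1
    change _ = Complex.exp _
    rw [← Complex.exp_add]
    congr 1
    push_cast
    ring
  refine Lp.ext ?_
  filter_upwards [this, Lp.coeFn_zero ℂ q (volume.restrict I)] with x hx h0
  rw [h0, Pi.zero_apply]
  exact (mul_eq_zero.1 hx).resolve_left (Complex.exp_ne_zero _)

/-- The map `1 + iR`, with `R` the reflection, turning FK boundary conditions into quasi-periodic
ones. -/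
def untwist : LqI q →L[ℂ] LqI q :=
  ContinuousLinearMap.id ℂ _ + Complex.I • reflection.toContinuousLinearMap

/-- The inverse `(1 - iR) / 2` of `untwist`. -/
def retwist : LqI q →L[ℂ] LqI q :=
  (2⁻¹ : ℂ) • (ContinuousLinearMap.id ℂ _ - Complex.I • reflection.toContinuousLinearMap)

theorem untwist_apply (f : LqI q) : untwist f = f + Complex.I • reflection f := rfl

theorem retwist_apply (f : LqI q) : retwist f = (2⁻¹ : ℂ) • (f - Complex.I • reflection f) := rfl

theorem untwist_retwist (f : LqI q) : untwist (retwist f) = f := by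
  rw [untwist_apply, retwist_apply, map_smul, map_sub, map_smul, reflection_reflection,
    smul_comm Complex.I, ← smul_add, smul_sub, smul_smul, Complex.I_mul_I]
  have : f - Complex.I • reflection f + (Complex.I • reflection f - (-1 : ℂ) • f)
      = (2 : ℂ) • f := by
    rw [two_smul, neg_smul, one_smul]
    abel
  rw [this, smul_smul]
  norm_num

theorem norm_untwist_le (f : LqI q) : ‖untwist f‖ ≤ 2 * ‖f‖ := by
  rw [untwist_apply]
  refine (norm_add_le _ _).trans_eq ?_
  rw [norm_smul, Complex.norm_I, LinearIsometry.norm_map]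
  ring

theorem norm_retwist_le (f : LqI q) : ‖retwist f‖ ≤ ‖f‖ := by
  rw [retwist_apply, norm_smul]
  have := norm_sub_le f (Complex.I • reflection f)
  rw [norm_smul, Complex.norm_I, LinearIsometry.norm_map] at this
  norm_num
  linarith

/-- The substitution x ↦ -x moves the reflection onto the exponential: `eigenfun κ` is the transpose
of 1 + iR applied to e^{-iκx}. -/
theorem pairing_eigenfun_eq (κ : ℝ) (f : LqI q) :
    pairing q (eigenfun κ) f = pairing q (expfun κ) (untwist f) := by
  have hr : pairing q (expfun κ) (reflection f)
      = ∫ x in I, Complex.exp (Complex.I * κ * x) * f x := by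
    rw [pairing_apply, ← measurePreserving_neg_I.integral_comp
      (Homeomorph.neg ℝ).measurableEmbedding]
    refine integral_congr_ae ?_
    filter_upwards [measurePreserving_neg_I.quasiMeasurePreserving.ae (coeFn_reflection f)]
      with x hx
    rw [hx, neg_neg]
    congr 1
    change Complex.exp _ = _
    congr 1
    push_cast
    ring
  rw [untwist_apply, map_add, map_smul, hr, pairing_apply, pairing_apply, smul_eq_mul,
    ← integral_const_mul, ← integral_add (integrable_I_mul (expfun κ).continuous (LqI.integrable f))
      ((integrable_I_mul (by fun_prop) (LqI.integrable f)).const_mul _)]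
  congr 1 with x
  rw [eigenfun_apply, add_mul, mul_assoc Complex.I (Complex.exp _)]
  rfl

/-- The group whose squared generator is the FK operator. -/
def fkGroup (c s : ℝ) : LqI q →L[ℂ] LqI q :=
  retwist.comp ((twistedTranslation c s).comp untwist)

theorem fkGroup_apply (c s : ℝ) (f : LqI q) :
    fkGroup c s f = retwist (twistedTranslation c s (untwist f)) := rfl

theorem norm_fkGroup_apply_le (c s : ℝ) (f : LqI q) : ‖fkGroup c s f‖ ≤ 2 * ‖f‖ := by
  rw [fkGroup_apply]
  refine (norm_retwist_le _).trans ?_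
  exact (norm_twistedTranslation_le c s _).trans (norm_untwist_le f)

theorem norm_fkGroup_le (q : ℝ≥0∞) [Fact (1 ≤ q)] (c s : ℝ) : ‖fkGroup (q := q) c s‖ ≤ 2 := by
  refine ContinuousLinearMap.opNorm_le_bound _ zero_le_two ?_
  exact norm_fkGroup_apply_le c s

theorem retwist_untwist (f : LqI q) : retwist (untwist f) = f := by
  have h1 : reflection (untwist f) = reflection f + Complex.I • f := by
    rw [untwist_apply, map_add, map_smul, reflection_reflection]
  rw [retwist_apply, h1, untwist_apply, smul_add, smul_smul, Complex.I_mul_I, neg_smul, one_smul,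
    show f + Complex.I • reflection f - (Complex.I • reflection f + -f) = (2 : ℂ) • f by
      rw [two_smul]; abel, smul_smul]
  norm_num

theorem isDiagonalGroup_fkGroup (hq2 : q ≠ ⊤) (c : ℝ) :
    IsDiagonalGroup (X := LqI q) 2 (fkGroup c) (fun n : ℤ => Real.pi * n - c)
      (fun n => pairing q (eigenfun (Real.pi * n - c))) := by
  refine ⟨norm_fkGroup_le q c, fun f => ?_, fun n s f => ?_, fun f h => ?_⟩
  · exact retwist.continuous.comp (continuous_twistedTranslation hq2 c (untwist f))
  · rw [fkGroup_apply, pairing_eigenfun_eq, untwist_retwist, pairing_twistedTranslation,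
      pairing_eigenfun_eq]
  · have h0 : untwist f = 0 := eq_zero_of_pairing_expfun c _ fun n => by
      rw [← pairing_eigenfun_eq, h n]
    rw [← retwist_untwist f, h0, map_zero]

end Group

/-! ### The FK frequencies, and A_q as the operator with symbol -κ². -/

section Main

theorem one_add_I_mul_ne_zero (a : ℝ) : (1 : ℂ) + Complex.I * a ≠ 0 := fun h => by
  have := congrArg Complex.re h
  simp at this

/-- The quasi-periodicity factor of the FK boundary conditions. -/
def fkFactor (θ : ℝ) : ℂ := ((1 - θ : ℝ) + Complex.I) / (1 + Complex.I * (1 - θ : ℝ))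

theorem norm_fkFactor (θ : ℝ) : ‖fkFactor θ‖ = 1 := by
  -- The numerator is i times the conjugate of the denominator.
  have h : ((1 - θ : ℝ) : ℂ) + Complex.I
      = Complex.I * (starRingEnd ℂ) (1 + Complex.I * (1 - θ : ℝ)) := by
    rw [map_add, map_mul, map_one, Complex.conj_I, Complex.conj_ofReal]
    linear_combination ((1 - θ : ℝ) : ℂ) * Complex.I_sq
  rw [fkFactor, norm_div, h, norm_mul, Complex.norm_I, one_mul, Complex.norm_conj,
    div_self (norm_ne_zero_iff.2 (one_add_I_mul_ne_zero _))]

theorem fkFactor_ne_one {θ : ℝ} (hθ : θ ≠ 0) : fkFactor θ ≠ 1 := fun h => by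
  rw [fkFactor, div_eq_one_iff_eq (one_add_I_mul_ne_zero _)] at h
  have := congrArg Complex.re h
  simp at this
  exact hθ this

/-- Half the argument of the quasi-periodicity factor. -/
def fkPhase (θ : ℝ) : ℝ := (fkFactor θ).arg / 2

/-- The square roots of the negatives of the eigenvalues of the FK operator. -/
def fkFrequency (θ : ℝ) (n : ℤ) : ℝ := Real.pi * n - fkPhase θ

/-- The factor is unimodular, so it equals e^{i arg}, and the term πn contributes a multiple of 2πi.
This is the condition required by `IsFK.pairing_eigenfun`, up to clearing the denominator. -/
theorem exp_fkFrequency (θ : ℝ) (n : ℤ) :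
    Complex.exp (-2 * Complex.I * fkFrequency θ n) = fkFactor θ := by
  have h := Complex.norm_mul_exp_arg_mul_I (fkFactor θ)
  rw [norm_fkFactor, Complex.ofReal_one, one_mul] at h
  rw [fkFrequency, fkPhase]
  push_cast
  rw [show -2 * Complex.I * ((Real.pi : ℂ) * n - (fkFactor θ).arg / 2)
      = (fkFactor θ).arg * Complex.I + (-n : ℤ) * (2 * Real.pi * Complex.I) by push_cast; ring,
    Complex.exp_add, Complex.exp_int_mul_two_pi_mul_I, mul_one, h]

variable {q : ℝ≥0∞} [hq : Fact (1 ≤ q)]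

theorem isDiagonalGroup_fkFrequency (hq2 : q ≠ ⊤) (θ : ℝ) :
    IsDiagonalGroup (X := LqI q) 2 (fkGroup (fkPhase θ)) (fkFrequency θ)
      (fun n => pairing q (eigenfun (fkFrequency θ n))) :=
  isDiagonalGroup_fkGroup hq2 (fkPhase θ)

/-- The FK operator is the Fourier multiplier with symbol `-κ²`. -/
theorem mem_graph_opA_iff_pairing (hq2 : q ≠ ⊤) {θ : ℝ} (hθ0 : 0 ≤ θ) (u w : LqI q) :
    (u, w) ∈ (opA q θ).graph ↔ ∀ n, pairing q (eigenfun (fkFrequency θ n)) w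
      = -(fkFrequency θ n : ℂ) ^ 2 * pairing q (eigenfun (fkFrequency θ n)) u := by
  have hfwd : ∀ {u v w : LqI q}, IsFK θ u v w → ∀ n, pairing q (eigenfun (fkFrequency θ n)) w
      = -(fkFrequency θ n : ℂ) ^ 2 * pairing q (eigenfun (fkFrequency θ n)) u := fun h n => by
    refine h.pairing_eigenfun ?_
    have := one_add_I_mul_ne_zero (1 - θ)
    push_cast at this
    rw [exp_fkFrequency, fkFactor]
    push_cast
    exact div_mul_cancel₀ _ this
  rw [mem_graph_opA]
  refine ⟨fun ⟨v, h⟩ => hfwd h, fun h => ?_⟩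
  -- Both u' and u have ℓ n values solving (1 + κ²)y = ℓ n (u - w); since 1 + κ² ≠ 0, separation
  -- forces u' = u, so u lies in the domain.
  obtain ⟨u', v', h'⟩ := exists_isFK_sub_eq hθ0 (u - w)
  have hu : u' = u := (isDiagonalGroup_fkFrequency hq2 θ).ext fun n => by
    have h1 := hfwd h' n
    have h2 := h n
    rw [map_sub, map_sub] at h1
    have hpos : (1 : ℂ) + (fkFrequency θ n : ℂ) ^ 2 ≠ 0 := by
      have : (0 : ℝ) < 1 + fkFrequency θ n ^ 2 := by positivity
      exact_mod_cast this.ne'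
    refine mul_left_cancel₀ hpos ?_
    linear_combination h1 - h2
  rw [hu, sub_sub_cancel] at h'
  exact ⟨v', h'⟩

end Main

end FK

end

theorem mainTheorem5 (q : ENNReal) [Fact (1 ≤ q)] (hq1 : 1 < q) (hq2 : q ≠ ⊤)
    (θ₀ : ℝ) (hθ0 : 0 ≤ θ₀) (hθ1 : θ₀ ≤ 1) :
    (∀ φ : ℝ, Real.pi / 2 < φ → φ < Real.pi →
      ∃ C : ℝ, ∀ z ∈ FK.sector φ, ∀ f : FK.LqI q,
        (∃! u : (FK.opA q θ₀).domain, z • (u : FK.LqI q) - FK.opA q θ₀ u = f) ∧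
        ∀ u : (FK.opA q θ₀).domain, z • (u : FK.LqI q) - FK.opA q θ₀ u = f →
          ‖z‖ * ‖(u : FK.LqI q)‖ + ‖FK.opA q θ₀ u‖ ≤ C * ‖f‖) ∧
    (0 < θ₀ → (0 : ℂ) ∈ FK.resolventSet (FK.opA q θ₀)) ∧
    (∀ z ∈ FK.spectrum (FK.opA q θ₀), z.im = 0 ∧ z.re ≤ 0 ∧ (0 < θ₀ → z.re < 0)) ∧
    FK.GeneratesAnalyticSemigroup (FK.opA q θ₀) := by
  have hG := FK.isDiagonalGroup_fkFrequency hq2 θ₀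
  have hA := FK.mem_graph_opA_iff_pairing (q := q) hq2 hθ0
  have hzero : 0 < θ₀ → (0 : ℂ) ∈ FK.resolventSet (FK.opA q θ₀) := fun hθ => by
    -- The inverse appears because `exp_fkFrequency` concerns e^{-2iκ}, while `exists_inverse` asks
    -- for e^{2iκ}.
    have hη : (FK.fkFactor θ₀)⁻¹ ≠ 1 := fun h => FK.fkFactor_ne_one hθ.ne' (inv_eq_one.1 h)
    obtain ⟨hne, R, hR⟩ := hG.exists_inverse hη fun n => by
      rw [← FK.exp_fkFrequency θ₀ n, ← Complex.exp_neg]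
      ring_nf
    exact ⟨R, hG.resolvent_spec hA hne hR⟩
  -- The group bound is M = 2. The outer 2 and the +1 come from A u = zu - f, which gives ‖Au‖ ≤
  -- |z|‖u‖ + ‖f‖.
  refine ⟨fun φ _ hφ => ⟨2 * (2 ^ 2 / Real.cos (φ / 2) ^ 2) + 1, fun z hz f => ?_⟩, hzero,
    fun z hz => ?_, Real.pi / 2, by positivity, le_rfl, hG.heat, hG.isAnalyticSemigroup_heat,
    hG.isGenerator_heat hA⟩
  · obtain ⟨hne, R, hRn, hR⟩ := hG.exists_resolvent hφ hz
    obtain ⟨h1, h2⟩ := hG.resolvent_spec hA hne hR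
    refine ⟨?_, fun u hu => ?_⟩
    · obtain ⟨u, -, hu⟩ := h1 f
      refine ⟨u, hu, fun u' hu' => Subtype.ext ?_⟩
      rw [← h2 u, ← h2 u', hu, hu']
    · have hRu : R f = u := by rw [← h2 u, hu]
      have hz1 : ‖z‖ * ‖(u : FK.LqI q)‖ ≤ 2 ^ 2 / Real.cos (φ / 2) ^ 2 * ‖f‖ := by
        rw [← hRu]
        calc ‖z‖ * ‖R f‖ ≤ ‖z‖ * (‖R‖ * ‖f‖) := by
              gcongr
              exact R.le_opNorm f
          _ ≤ _ := by
              rw [← mul_assoc]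
              gcongr
      have hAu : FK.opA q θ₀ u = z • (u : FK.LqI q) - f := by rw [← hu, sub_sub_cancel]
      have hz2 : ‖FK.opA q θ₀ u‖ ≤ ‖z‖ * ‖(u : FK.LqI q)‖ + ‖f‖ := by
        rw [hAu, ← norm_smul]
        exact norm_sub_le _ _
      linarith
  · have hmain : z.im = 0 ∧ z.re ≤ 0 := by
      by_contra hcon
      refine hz ?_
      have hz0 : z ≠ 0 := fun h => hcon (by simp [h])
      have harg : |z.arg| < Real.pi := by
        refine lt_of_le_of_ne (Complex.abs_arg_le_pi z) fun h => hcon ?_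
        have hpi : z.arg = Real.pi := by
          rcases abs_eq Real.pi_pos.le |>.1 h with h | h
          · exact h
          · exact absurd h (Complex.neg_pi_lt_arg z).ne'
        rw [Complex.arg_eq_pi_iff] at hpi
        exact ⟨hpi.2, hpi.1.le⟩
      -- Every z off (-∞, 0] lies in some sector of angle φ < π, where the resolvent has been built.
      obtain ⟨φ, h1, h2⟩ := exists_between harg
      obtain ⟨hne, R, -, hR⟩ := hG.exists_resolvent h2 (z := z) ⟨hz0, h1⟩
      exact ⟨R, hG.resolvent_spec hA hne hR⟩
    refine ⟨hmain.1, hmain.2, fun hθ => lt_of_le_of_ne hmain.2 fun h => hz ?_⟩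
    rw [show z = 0 from Complex.ext h hmain.1]
    exact hzero hθ
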